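/- A grounded $L$-shape is a curve that consists of a vertical segment from a point $(x,0)$ of the ground line (the $x$-axis) up to a bend $(x,h)$, $h>0$, followed by a horizontal segment from the bend to a free endpoint $(r,h)$ with $r\neq x$. A finite family $S$ of grounded $L$-shapes is one-sided if all of its shapes turn clockwise (all have $r>x$) or all turn anticlockwise (all have $r<x$), and it is in general position if no two of the vertical segments lie on a common vertical line and no two of the horizontal segments lie on a common horizontal line. Two shapes are adjacent in the intersection graph of $S$ if they have a common point. Given a one-sided family $S$ of $n$ grounded $L$-shapes in general position (by the three real numbers $x,h,r$ of each shape), a maximum clique of the intersection graph of $S$ can be found in $O(n^2\log\log n)$ time. That is, there are a program for a unit-cost random access machine on words of $w$ bits, whose only access to the input numbers is by unit-cost comparisons of two of them, a constant $c\ge 1$, and a function $T(n)=O(n^2\log\log n)$ such that for every $n$, every such $S$ and every word length $w\ge c\log_2(n+2)$, the program halts after at most $T(n)$ steps and outputs the list (without repetition) of the indices of a maximum clique. Moreover, for $q\in S$ let $N(q)$ be the set of the shapes $p\in S$, $p\ne q$, that intersect the vertical segment of $q$, and for $A\subseteq S$ let $D(A)$ be the maximum size of a clique in the subgraph induced by $A$.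 Then $D(S)=\max_{q\in S}\,(D(N(q))+1)$ if $n\ge 1$, and for every $q\in S$ the subgraph induced by $N(q)$ is a permutation graph, i.e. an intersection graph of straight line segments that join two parallel lines. -/

import Mathlib

open Asymptotics Filter

/-! ### Grounded L-shapes, intersection graphs, permutation graphs -/

/-- The intersection graph of a family of sets: two distinct indices are adjacent when the
corresponding sets have a common point. -/
def intersectionGraph {ι X : Type*} (A : ι → Set X) : SimpleGraph ι where
  Adj i j := i ≠ j ∧ (A i ∩ A j).Nonempty
  symm := ⟨fun _ _ h => ⟨h.1.symm, by rw [Set.inter_comm]; exact h.2⟩⟩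
  loopless := ⟨fun _ h => h.1 rfl⟩

/-- A permutation graph: the intersection graph of straight line segments that join two parallel
lines (here `y = 0` and `y = 1`). -/
def IsPermutationGraph {V : Type*} (G : SimpleGraph V) : Prop :=
  ∃ bot top : V → ℝ,
    G = intersectionGraph fun v => segment ℝ ((bot v, 0) : ℝ × ℝ) ((top v, 1) : ℝ × ℝ)

/-- A grounded L-shape over the ground line `y = 0`: a vertical segment from the fixed endpoint
`(foot, 0)` up to the bend `(foot, height)`, followed by a horizontal segment from the bend to the
free endpoint `(tip, height)`. -/
structure LShape where
  foot : ℝ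
  height : ℝ
  tip : ℝ
  height_pos : 0 < height
  tip_ne_foot : tip ≠ foot

namespace LShape

/-- The vertical segment. -/
def vertical (a : LShape) : Set (ℝ × ℝ) := segment ℝ (a.foot, 0) (a.foot, a.height)

/-- The horizontal segment. -/
def horizontal (a : LShape) : Set (ℝ × ℝ) := segment ℝ (a.foot, a.height) (a.tip, a.height)

/-- The whole curve. -/
def curve (a : LShape) : Set (ℝ × ℝ) := a.vertical ∪ a.horizontal

/-- All shapes turn clockwise (to the right, coming from the ground line), or all of them turn
anticlockwise. -/
def OneSided {ι : Type*} (S : ι → LShape) : Prop :=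
  (∀ i, (S i).foot < (S i).tip) ∨ (∀ i, (S i).tip < (S i).foot)

/-- No two vertical segments lie on a common vertical line and no two horizontal segments lie on a
common horizontal line. -/
def GeneralPosition {ι : Type*} (S : ι → LShape) : Prop :=
  Function.Injective (fun i => (S i).foot) ∧ Function.Injective (fun i => (S i).height)

/-- The intersection graph of a family of L-shapes. -/
def graph {ι : Type*} (S : ι → LShape) : SimpleGraph ι := intersectionGraph fun i => (S i).curve

/-- `N(q)`: the shapes, other than `q` itself, that meet the vertical segment of `q`. -/
def N {ι : Type*} (S : ι → LShape) (q : ι) : Set ι :=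
  {p | p ≠ q ∧ ((S p).curve ∩ (S q).vertical).Nonempty}

/-- `D(A)`: the maximum size of a clique among the shapes with index in `A`. -/
noncomputable def D {ι : Type*} (S : ι → LShape) (A : Set ι) : ℕ := ((graph S).induce A).cliqueNum

end LShape

/-! ### A word RAM with comparison access to an input of real numbers

Words are the natural numbers below `2 ^ w`. A program is a structured (while-)program; it uses
finitely many word variables and finitely many arrays of words, all with unit-cost access. The
input consists of `n` records of `k` real numbers each; the only access to these numbers is a
unit-cost comparison of two of them. -/

namespace WordRAM

/-- Arithmetic and bitwise instructions on words. -/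
inductive Op where
  | add | sub | mul | div | mod | and | or | xor | shl | shr

/-- All results are reduced modulo `2 ^ w`; subtraction is cut off at zero. -/
def Op.eval (w : ℕ) : Op → ℕ → ℕ → ℕ
  | .add, a, b => (a + b) % 2 ^ w
  | .sub, a, b => (a - b) % 2 ^ w
  | .mul, a, b => (a * b) % 2 ^ w
  | .div, a, b => (a / b) % 2 ^ w
  | .mod, a, b => (a % b) % 2 ^ w
  | .and, a, b => (a &&& b) % 2 ^ w
  | .or, a, b => (a ||| b) % 2 ^ w
  | .xor, a, b => (a ^^^ b) % 2 ^ w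
  | .shl, a, b => (a <<< b) % 2 ^ w
  | .shr, a, b => (a >>> b) % 2 ^ w

/-- Word-valued terms: constants, variables, array cells, and operations. -/
inductive Term where
  | const (c : ℕ)
  | var (v : ℕ)
  | read (A : ℕ) (i : Term)
  | op (o : Op) (a b : Term)

/-- Tests. `.input f i g j` compares two input numbers: field `f` of record `i` is less than
field `g` of record `j`. -/
inductive Test (k : ℕ) where
  | lt (a b : Term)
  | eq (a b : Term)
  | input (f : Fin k) (i : Term) (g : Fin k) (j : Term)
  | not (c : Test k)
  | and (c d : Test k)
  | or (c d : Test k)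

/-- Programs, for inputs whose records have `k` fields. -/
inductive Prog (k : ℕ) where
  | skip
  | assign (v : ℕ) (e : Term)
  | write (A : ℕ) (i e : Term)
  | seq (p q : Prog k)
  | branch (c : Test k) (p q : Prog k)
  | loop (c : Test k) (p : Prog k)

/-- The contents of the variables and of the arrays. -/
structure State where
  var : ℕ → ℕ
  arr : ℕ → ℕ → ℕ

/-- Initially variable `0` holds the number `n` of records, everything else is `0`. -/
def State.init (n : ℕ) : State where
  var := Function.update (fun _ => 0) 0 n
  arr := fun _ _ => 0

/-- Store `x` in variable `v`. -/
def State.setVar (s : State) (v x : ℕ) : State where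
  var := Function.update s.var v x
  arr := s.arr

/-- Store `x` in cell `i` of array `A`. -/
def State.setArr (s : State) (A i x : ℕ) : State where
  var := s.var
  arr := Function.update s.arr A (Function.update (s.arr A) i x)

/-- The output: the first `k` cells of array `0`, where `k` is the content of variable `0`. -/
def State.output (s : State) : List ℕ := (List.range (s.var 0)).map (s.arr 0)

/-- The value of a term in a state. -/
def Term.eval (w : ℕ) (s : State) : Term → ℕ
  | .const c => c % 2 ^ w
  | .var v => s.var v
  | .read A i => s.arr A (i.eval w s)
  | .op o a b => o.eval w (a.eval w s) (b.eval w s)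

/-- The truth of a test in a state; comparing records that do not exist gives false. -/
def Test.Holds {n k : ℕ} (w : ℕ) (inp : Fin n → Fin k → ℝ) (s : State) : Test k → Prop
  | .lt a b => a.eval w s < b.eval w s
  | .eq a b => a.eval w s = b.eval w s
  | .input f i g j => ∃ (hi : i.eval w s < n) (hj : j.eval w s < n),
      inp ⟨i.eval w s, hi⟩ f < inp ⟨j.eval w s, hj⟩ g
  | .not c => ¬ c.Holds w inp s
  | .and c d => c.Holds w inp s ∧ d.Holds w inp s
  | .or c d => c.Holds w inp s ∨ d.Holds w inp s

/-- The number of steps for evaluating a term: one per constant, variable, access, operation. -/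
def Term.cost : Term → ℕ
  | .const _ => 1
  | .var _ => 1
  | .read _ i => i.cost + 1
  | .op _ a b => a.cost + b.cost + 1

/-- The number of steps for evaluating a test. -/
def Test.cost {k : ℕ} : Test k → ℕ
  | .lt a b => a.cost + b.cost + 1
  | .eq a b => a.cost + b.cost + 1
  | .input _ i _ j => i.cost + j.cost + 1
  | .not c => c.cost + 1
  | .and c d => c.cost + d.cost + 1
  | .or c d => c.cost + d.cost + 1

/-- `Exec w inp p s t s'`: on words of `w` bits and input `inp`, the program `p`, started in the
state `s`, halts after exactly `t` steps in the state `s'`. -/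
inductive Exec {n k : ℕ} (w : ℕ) (inp : Fin n → Fin k → ℝ) :
    Prog k → State → ℕ → State → Prop where
  | skip (s : State) : Exec w inp .skip s 1 s
  | assign (v : ℕ) (e : Term) (s : State) :
      Exec w inp (.assign v e) s (e.cost + 1)
        (s.setVar v (e.eval w s))
  | write (A : ℕ) (i e : Term) (s : State) :
      Exec w inp (.write A i e) s (i.cost + e.cost + 1)
        (s.setArr A (i.eval w s) (e.eval w s))
  | seq {p q : Prog k} {s s₁ s₂ : State} {t₁ t₂ : ℕ} :
      Exec w inp p s t₁ s₁ → Exec w inp q s₁ t₂ s₂ → Exec w inp (.seq p q) s (t₁ + t₂) s₂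
  | branch_true {c : Test k} {p q : Prog k} {s s₁ : State} {t : ℕ} :
      c.Holds w inp s → Exec w inp p s t s₁ → Exec w inp (.branch c p q) s (c.cost + 1 + t) s₁
  | branch_false {c : Test k} {p q : Prog k} {s s₁ : State} {t : ℕ} :
      ¬ c.Holds w inp s → Exec w inp q s t s₁ → Exec w inp (.branch c p q) s (c.cost + 1 + t) s₁
  | loop_true {c : Test k} {p : Prog k} {s s₁ s₂ : State} {t₁ t₂ : ℕ} :
      c.Holds w inp s → Exec w inp p s t₁ s₁ → Exec w inp (.loop c p) s₁ t₂ s₂ →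
        Exec w inp (.loop c p) s (c.cost + 1 + t₁ + t₂) s₂
  | loop_false {c : Test k} {p : Prog k} {s : State} :
      ¬ c.Holds w inp s → Exec w inp (.loop c p) s (c.cost + 1) s

end WordRAM

/-- The input for a family of `n` L-shapes: record `i` holds the three coordinates of shape `i`. -/
def LShape.encode {n : ℕ} (S : Fin n → LShape) : Fin n → Fin 3 → ℝ :=
  fun i => ![(S i).foot, (S i).height, (S i).tip]

/-! ### Crossings of grounded L-shapes -/

namespace LShape

/-! After a reflection of the ground line all shapes turn clockwise. By general position two shapes
meet only where the horizontal segment of one hits the vertical segment of the other; the first then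
has the smaller foot and the smaller height, and its tip reaches the foot of the second
(`graph_adj_iff`). Hence all shapes of a clique meet the vertical segment of the shape `q` with the
last foot, which gives the recursion (`isGreatest_D`). A shape in `N S q` reaches the foot of `q`,
so it reaches every foot between its own and that of `q`. Adjacency inside `N S q` therefore means
that feet and heights are ordered alike: this is a permutation graph, and its cliques are chains
along which feet and heights both increase.

A maximum clique is thus a longest such chain over all `q`, plus `q`. The chains for all `q`
together are found in `O(n²)` steps, so the factor `log log n` is slack. In a sweep over `q` in foot
order, the candidates are the positions before `q` whose tips reach `q`, with no restriction by the
height of `q`. When `q` advances, this set loses members and gains only `q` itself, so the longest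
chain ending at a fixed position never grows. A bound `L a` on that length is kept from row to row
and lowered by one until the table `M` of lowest chain ends per level confirms it
(`Tables.decrease`, `Tables.place`, `Tables.next`). The lowerings are paid for by the sum of `L`,
initially `n²`; the other steps are at most quadratic in number. The height of `q` enters only in
`Best`: the end of a chain is its highest member, so only that end has to be lower than `q`. -/

theorem mem_vertical (a : LShape) (z : ℝ × ℝ) :
    z ∈ a.vertical ↔ z.1 = a.foot ∧ 0 ≤ z.2 ∧ z.2 ≤ a.height := by
  obtain ⟨x, y⟩ := z
  rw [vertical, ← Prod.image_mk_segment_right, segment_eq_uIcc, Set.uIcc_of_le a.height_pos.le]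
  constructor
  · rintro ⟨t, ht, h⟩
    simp only [Prod.mk.injEq] at h
    exact ⟨h.1.symm, h.2 ▸ ht.1, h.2 ▸ ht.2⟩
  · rintro ⟨h1, h2, h3⟩
    exact ⟨y, ⟨h2, h3⟩, by simp_all⟩

theorem mem_horizontal (a : LShape) (z : ℝ × ℝ) :
    z ∈ a.horizontal ↔ z.1 ∈ Set.uIcc a.foot a.tip ∧ z.2 = a.height := by
  obtain ⟨x, y⟩ := z
  rw [horizontal, ← Prod.image_mk_segment_left, segment_eq_uIcc]
  constructor
  · rintro ⟨t, ht, h⟩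
    simp only [Prod.mk.injEq] at h
    exact ⟨h.1 ▸ ht, h.2.symm⟩
  · rintro ⟨h1, h2⟩
    exact ⟨x, h1, by simp_all⟩

/-- The identity or the reflection of the ground line. -/
def orient (b : Bool) (x : ℝ) : ℝ := if b then x else -x

/-- All shapes turn clockwise (`b = true`) or anticlockwise (`b = false`). -/
def Turns {ι : Type*} (b : Bool) (S : ι → LShape) : Prop :=
  ∀ i, orient b (S i).foot < orient b (S i).tip

theorem OneSided.exists_turns {ι : Type*} {S : ι → LShape} (h : OneSided S) :
    ∃ b, Turns b S := by
  rcases h with h | h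
  · exact ⟨true, fun i => by simpa [orient] using h i⟩
  · exact ⟨false, fun i => by simpa [orient] using h i⟩

/-- The horizontal segment of `p` crosses the vertical segment of `q`. -/
def Crosses {ι : Type*} (b : Bool) (S : ι → LShape) (p q : ι) : Prop :=
  orient b (S p).foot < orient b (S q).foot ∧ orient b (S q).foot ≤ orient b (S p).tip ∧
    (S p).height < (S q).height

variable {ι : Type*} {S : ι → LShape} {b : Bool}

theorem orient_foot_injective (b : Bool) (hg : GeneralPosition S) :
    Function.Injective fun i => orient b (S i).foot := by
  intro i j h
  apply hg.1
  cases b <;> simpa [orient] using h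

/-- The only possible common point is `((S q).foot, (S p).height)`. General position makes the
comparisons of feet and of heights strict; a tip may touch the vertical segment, so that comparison
stays weak. -/
theorem horizontal_inter_vertical (ht : Turns b S) (hg : GeneralPosition S) {p q : ι}
    (hpq : p ≠ q) :
    ((S p).horizontal ∩ (S q).vertical).Nonempty ↔ Crosses b S p q := by
  have hf : (S p).foot ≠ (S q).foot := fun h => hpq (hg.1 h)
  have hh : (S p).height ≠ (S q).height := fun h => hpq (hg.2 h)
  have hp := ht p
  have hp0 := (S p).height_pos
  constructor
  · rintro ⟨z, hz1, hz2⟩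
    rw [mem_horizontal] at hz1
    rw [mem_vertical] at hz2
    obtain ⟨h1, h2⟩ := hz1
    obtain ⟨h3, -, h4⟩ := hz2
    rw [h3] at h1
    rw [h2] at h4
    cases b
    · simp only [orient, Bool.false_eq_true, if_false] at hp
      rw [Set.uIcc_of_ge (by linarith)] at h1
      simp only [Crosses, orient, Bool.false_eq_true, if_false, neg_lt_neg_iff, neg_le_neg_iff]
      exact ⟨lt_of_le_of_ne h1.2 hf.symm, h1.1, lt_of_le_of_ne h4 hh⟩
    · simp only [orient, if_true] at hp
      rw [Set.uIcc_of_le (by linarith)] at h1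
      simp only [Crosses, orient, if_true]
      exact ⟨lt_of_le_of_ne h1.1 hf, h1.2, lt_of_le_of_ne h4 hh⟩
  · rintro ⟨h1, h2, h3⟩
    refine ⟨((S q).foot, (S p).height), (mem_horizontal _ _).2 ⟨?_, rfl⟩,
      (mem_vertical _ _).2 ⟨rfl, hp0.le, h3.le⟩⟩
    cases b
    · simp only [orient, Bool.false_eq_true, if_false, neg_lt_neg_iff, neg_le_neg_iff] at h1 h2
      rw [Set.uIcc_of_ge (by linarith)]
      exact ⟨h2, h1.le⟩
    · simp only [orient, if_true] at h1 h2
      rw [Set.uIcc_of_le (by linarith)]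
      exact ⟨h1.le, h2⟩

theorem vertical_inter_vertical (hg : GeneralPosition S) {p q : ι} (hpq : p ≠ q) :
    ¬ ((S p).vertical ∩ (S q).vertical).Nonempty := by
  rintro ⟨z, h1, h2⟩
  rw [mem_vertical] at h1 h2
  exact hpq (hg.1 (h1.1.symm.trans h2.1))

theorem horizontal_inter_horizontal (hg : GeneralPosition S) {p q : ι} (hpq : p ≠ q) :
    ¬ ((S p).horizontal ∩ (S q).horizontal).Nonempty := by
  rintro ⟨z, h1, h2⟩
  rw [mem_horizontal] at h1 h2
  exact hpq (hg.2 (h1.2.symm.trans h2.2))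

theorem mem_N_iff (ht : Turns b S) (hg : GeneralPosition S) {p q : ι} :
    p ∈ N S q ↔ Crosses b S p q := by
  constructor
  · rintro ⟨hpq, hn⟩
    rw [curve, Set.union_inter_distrib_right, Set.union_nonempty] at hn
    exact (horizontal_inter_vertical ht hg hpq).1
      (hn.resolve_left (vertical_inter_vertical hg hpq))
  · intro h
    have hpq : p ≠ q := by rintro rfl; exact lt_irrefl _ h.1
    refine ⟨hpq, ?_⟩
    rw [curve, Set.union_inter_distrib_right, Set.union_nonempty]
    exact Or.inr ((horizontal_inter_vertical ht hg hpq).2 h)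

theorem graph_adj_iff (ht : Turns b S) (hg : GeneralPosition S) {p q : ι} :
    (graph S).Adj p q ↔ Crosses b S p q ∨ Crosses b S q p := by
  constructor
  · rintro ⟨hpq, hn⟩
    change ((S p).curve ∩ (S q).curve).Nonempty at hn
    rw [curve, curve, Set.inter_union_distrib_left, Set.union_inter_distrib_right,
      Set.union_inter_distrib_right, Set.union_nonempty, Set.union_nonempty,
      Set.union_nonempty] at hn
    rcases hn with (hn | hn) | (hn | hn)
    · exact absurd hn (vertical_inter_vertical hg hpq)
    · exact Or.inl ((horizontal_inter_vertical ht hg hpq).1 hn)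
    · rw [Set.inter_comm] at hn
      exact Or.inr ((horizontal_inter_vertical ht hg hpq.symm).1 hn)
    · exact absurd hn (horizontal_inter_horizontal hg hpq)
  · have key : ∀ p q, Crosses b S p q → (graph S).Adj p q := by
      intro p q h
      obtain ⟨hpq, z, hz1, hz2⟩ := (mem_N_iff ht hg).2 h
      exact ⟨hpq, z, hz1, Or.inl hz2⟩
    rintro (h | h)
    · exact key _ _ h
    · exact (key _ _ h).symm

/-! ### Cliques and the recursion for `D` -/

theorem N_subset_neighborSet (ht : Turns b S) (hg : GeneralPosition S) (q : ι) :
    N S q ⊆ (graph S).neighborSet q := fun _ hp =>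
  (graph_adj_iff ht hg).2 (Or.inr ((mem_N_iff ht hg).1 hp))

/-- A clique lies, except for its last shape, in the neighbourhood `N` of that shape. -/
theorem exists_subset_N_of_isClique (ht : Turns b S) (hg : GeneralPosition S)
    {s : Finset ι} (hs : (graph S).IsClique s) (hne : s.Nonempty) :
    ∃ q ∈ s, ∀ p ∈ s, p ≠ q → p ∈ N S q := by
  obtain ⟨q, hq, hmax⟩ := s.exists_max_image (fun i => orient b (S i).foot) hne
  refine ⟨q, hq, fun p hp hpq => (mem_N_iff ht hg).2 ?_⟩
  rcases (graph_adj_iff ht hg).1 (hs hp hq hpq) with h | h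
  · exact h
  · exact absurd (hmax p hp) (not_le.2 h.1)

theorem card_le_D [Finite ι] {A : Set ι} {s : Finset ι} (hs : (graph S).IsClique s)
    (hA : (s : Set ι) ⊆ A) : s.card ≤ D S A := by
  classical
  have : Finite A := Subtype.finite
  have hc : ((graph S).induce A).IsClique (s.subtype (· ∈ A) : Finset A) := by
    intro x hx y hy hxy
    simp only [Finset.mem_coe, Finset.mem_subtype] at hx hy
    exact hs hx hy (fun h => hxy (Subtype.ext h))
  have h1 := hc.card_le_cliqueNum
  rwa [Finset.card_subtype, Finset.filter_true_of_mem (fun x hx => hA hx)] at h1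

theorem exists_isClique_card_eq_D (S : ι → LShape) (A : Set ι) :
    ∃ s : Finset ι, (graph S).IsClique s ∧ (s : Set ι) ⊆ A ∧ s.card = D S A := by
  obtain ⟨t, htc⟩ := ((graph S).induce A).exists_isNClique_cliqueNum
  refine ⟨t.map (Function.Embedding.subtype _), ?_, ?_, ?_⟩
  · intro x hx y hy hxy
    simp only [Finset.coe_map, Function.Embedding.subtype_apply, Set.mem_image] at hx hy
    obtain ⟨x, hx, rfl⟩ := hx
    obtain ⟨y, hy, rfl⟩ := hy
    exact htc.isClique hx hy (fun h => hxy (h ▸ rfl))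
  · intro x hx
    simp only [Finset.coe_map, Function.Embedding.subtype_apply, Set.mem_image] at hx
    obtain ⟨x, -, rfl⟩ := hx
    exact x.2
  · rw [Finset.card_map, htc.card_eq]; rfl

/-- Adding `q` to a clique in `N S q` gives a clique; removing the shape with the last foot from a
maximum clique leaves a clique in the `N` of that shape. -/
theorem isGreatest_D [Finite ι] [Nonempty ι] (hS : OneSided S) (hg : GeneralPosition S) :
    IsGreatest (Set.range fun q => D S (N S q) + 1) (D S Set.univ) := by
  classical
  obtain ⟨b, ht⟩ := hS.exists_turns
  have hub : ∀ q, D S (N S q) + 1 ≤ D S Set.univ := by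
    intro q
    obtain ⟨s, hs, hsA, hcard⟩ := exists_isClique_card_eq_D S (N S q)
    have hq : q ∉ s := fun h => (hsA h).1 rfl
    rw [← hcard, ← Finset.card_insert_of_notMem hq]
    refine card_le_D ?_ (Set.subset_univ _)
    rw [Finset.coe_insert]
    exact hs.insert fun p hp _ => N_subset_neighborSet ht hg q (hsA hp)
  refine ⟨?_, ?_⟩
  · obtain ⟨s, hs, -, hcard⟩ := exists_isClique_card_eq_D S Set.univ
    have hne : s.Nonempty := by
      obtain ⟨i⟩ := ‹Nonempty ι›
      rw [← Finset.card_pos, hcard]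
      exact lt_of_lt_of_le (Nat.succ_pos _) (hub i)
    obtain ⟨q, hq, hqs⟩ := exists_subset_N_of_isClique ht hg hs hne
    refine ⟨q, le_antisymm (hub q) ?_⟩
    rw [← hcard, ← Finset.card_erase_add_one hq]
    refine Nat.succ_le_succ (card_le_D ?_ ?_)
    · exact hs.subset (by simp)
    · intro p hp
      simp only [Finset.coe_erase, Set.mem_sdiff, Finset.mem_coe, Set.mem_singleton_iff] at hp
      exact hqs p hp.1 hp.2
  · rintro _ ⟨q, rfl⟩
    exact hub q

/-! ### The permutation graph on `N(q)` -/

theorem mem_segment_ground_iff (x y : ℝ) (z : ℝ × ℝ) :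
    z ∈ segment ℝ ((x, 0) : ℝ × ℝ) ((y, 1) : ℝ × ℝ) ↔
      0 ≤ z.2 ∧ z.2 ≤ 1 ∧ z.1 = x + z.2 * (y - x) := by
  rw [segment_eq_image']
  constructor
  · rintro ⟨t, ht, rfl⟩
    simp [ht.1, ht.2]
  · rintro ⟨h1, h2, h3⟩
    refine ⟨z.2, ⟨h1, h2⟩, ?_⟩
    ext <;> simp [h3]

theorem segments_meet_iff {x y x' y' : ℝ} (hx : x < x') :
    (segment ℝ ((x, 0) : ℝ × ℝ) ((y, 1) : ℝ × ℝ) ∩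
      segment ℝ ((x', 0) : ℝ × ℝ) ((y', 1) : ℝ × ℝ)).Nonempty ↔ y' ≤ y := by
  constructor
  · rintro ⟨z, h1, h2⟩
    rw [mem_segment_ground_iff] at h1 h2
    by_contra! hy
    -- At height `t` the horizontal gap is `(1 - t) * (x' - x) + t * (y' - y)`, a convex combination
    -- of positive numbers, so it cannot vanish.
    nlinarith [mul_nonneg h1.1 (sub_nonneg.2 hy.le),
      mul_nonneg (sub_nonneg.2 h1.2.1) (sub_nonneg.2 hx.le)]
  · intro hy
    have hd : 0 < (x' - x) + (y - y') := by linarith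
    -- The second coordinate is the height at which the linear gap from `x' - x` to `y' - y`
    -- vanishes.
    refine ⟨(x + (x' - x) / ((x' - x) + (y - y')) * (y - x),
      (x' - x) / ((x' - x) + (y - y'))), ?_, ?_⟩
    · rw [mem_segment_ground_iff]
      refine ⟨div_nonneg (by linarith) hd.le, (div_le_one hd).2 (by linarith), rfl⟩
    · rw [mem_segment_ground_iff]
      refine ⟨div_nonneg (by linarith) hd.le, (div_le_one hd).2 (by linarith), ?_⟩
      field_simp
      ring

/-- The segment of a shape joins its oriented foot to minus its height. Two segments meet exactly
when the orders on the two lines are opposite, that is, when feet and heights are ordered alike. -/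
theorem isPermutationGraph_induce_N (hS : OneSided S) (hg : GeneralPosition S) (q : ι) :
    IsPermutationGraph ((graph S).induce (N S q)) := by
  obtain ⟨b, ht⟩ := hS.exists_turns
  refine ⟨fun v => orient b (S v).foot, fun v => -(S v).height, ?_⟩
  have key : ∀ p p' : N S q, orient b (S p).foot < orient b (S p').foot →
      ((graph S).Adj p p' ↔
        (segment ℝ ((orient b (S p).foot, 0) : ℝ × ℝ) ((-(S p).height, 1) : ℝ × ℝ) ∩
        segment ℝ ((orient b (S p').foot, 0) : ℝ × ℝ) ((-(S p').height, 1) : ℝ × ℝ)).Nonempty) := by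
    intro p p' hlt
    have hne : (S p).height ≠ (S p').height := fun h => by
      rw [hg.2 h] at hlt; exact lt_irrefl _ hlt
    have hp := (mem_N_iff ht hg).1 p.2
    have hp' := (mem_N_iff ht hg).1 p'.2
    rw [segments_meet_iff hlt, graph_adj_iff ht hg, neg_le_neg_iff]
    constructor
    · rintro (h | h)
      · exact h.2.2.le
      · exact absurd h.1 hlt.asymm
    · intro h
      exact Or.inl ⟨hlt, hp'.1.le.trans hp.2.1, lt_of_le_of_ne h hne⟩
  ext p p'
  change (graph S).Adj p p' ↔ p ≠ p' ∧ _
  by_cases hpp : p = p'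
  · subst hpp; simp
  · have hf : orient b (S p).foot ≠ orient b (S p').foot := fun h =>
      hpp (Subtype.ext (orient_foot_injective b hg h))
    rcases lt_or_gt_of_ne hf with h | h
    · rw [key p p' h]; exact (and_iff_right hpp).symm
    · rw [SimpleGraph.adj_comm, key p' p h, Set.inter_comm]; exact (and_iff_right hpp).symm

end LShape

/-! ### Program logic with running times -/

namespace WordRAM

/-- The largest number of steps of a program without loops. -/
def Prog.cost {k : ℕ} : Prog k → ℕ
  | .skip => 1
  | .assign _ e => e.cost + 1
  | .write _ i e => i.cost + e.cost + 1
  | .seq p q => p.cost + q.cost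
  | .branch c p q => c.cost + 1 + max p.cost q.cost
  | .loop c p => c.cost + 1 + p.cost

variable {n k : ℕ} (w : ℕ) (inp : Fin n → Fin k → ℝ)

/-- The weakest precondition of a program without loops. -/
def wp : Prog k → (State → Prop) → State → Prop
  | .skip, Q, s => Q s
  | .assign v e, Q, s => Q (s.setVar v (e.eval w s))
  | .write A i e, Q, s => Q (s.setArr A (i.eval w s) (e.eval w s))
  | .seq p q, Q, s => wp p (wp q Q) s
  | .branch c p q, Q, s => (c.Holds w inp s → wp p Q s) ∧ (¬ c.Holds w inp s → wp q Q s)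
  | .loop _ _, _, _ => False

/-- The program `p`, started in `s`, halts after at most `T` steps in a state satisfying `Q`. -/
def Halts (p : Prog k) (s : State) (T : ℕ) (Q : State → Prop) : Prop :=
  ∃ t s', t ≤ T ∧ Exec w inp p s t s' ∧ Q s'

variable {w inp}

/-- This serves loop-free programs, since `wp` of a loop is `False`. Nested iterations are
accordingly written as one loop whose body branches. -/
theorem Halts.of_wp {p : Prog k} {Q : State → Prop} {s : State} (h : wp w inp p Q s) :
    Halts w inp p s p.cost Q := by
  induction p generalizing Q s with
  | skip => exact ⟨_, _, le_rfl, .skip s, h⟩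
  | assign v e => exact ⟨_, _, le_rfl, .assign v e s, h⟩
  | write A i e => exact ⟨_, _, le_rfl, .write A i e s, h⟩
  | seq p q ihp ihq =>
    obtain ⟨t₁, s₁, ht₁, he₁, h₁⟩ := ihp h
    obtain ⟨t₂, s₂, ht₂, he₂, h₂⟩ := ihq h₁
    exact ⟨_, _, Nat.add_le_add ht₁ ht₂, .seq he₁ he₂, h₂⟩
  | branch c p q ihp ihq =>
    by_cases hc : c.Holds w inp s
    · obtain ⟨t₁, s₁, ht₁, he₁, h₁⟩ := ihp (h.1 hc)
      exact ⟨_, _, Nat.add_le_add_left (ht₁.trans (le_max_left _ _)) _, .branch_true hc he₁, h₁⟩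
    · obtain ⟨t₁, s₁, ht₁, he₁, h₁⟩ := ihq (h.2 hc)
      exact ⟨_, _, Nat.add_le_add_left (ht₁.trans (le_max_right _ _)) _, .branch_false hc he₁, h₁⟩
  | loop c p _ => exact h.elim

theorem Halts.mono {p : Prog k} {Q Q' : State → Prop} {s : State} {T T' : ℕ}
    (h : Halts w inp p s T Q) (hT : T ≤ T') (hQ : ∀ s, Q s → Q' s) : Halts w inp p s T' Q' := by
  obtain ⟨t, s', ht, he, hs⟩ := h
  exact ⟨t, s', ht.trans hT, he, hQ _ hs⟩

theorem Halts.seq {p q : Prog k} {P Q : State → Prop} {s : State} {T₁ T₂ : ℕ}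
    (h₁ : Halts w inp p s T₁ P) (h₂ : ∀ s', P s' → Halts w inp q s' T₂ Q) :
    Halts w inp (.seq p q) s (T₁ + T₂) Q := by
  obtain ⟨t₁, s₁, ht₁, he₁, hs₁⟩ := h₁
  obtain ⟨t₂, s₂, ht₂, he₂, hs₂⟩ := h₂ s₁ hs₁
  exact ⟨_, _, Nat.add_le_add ht₁ ht₂, .seq he₁ he₂, hs₂⟩

theorem Halts.branch {c : Test k} {p q : Prog k} {Q : State → Prop} {s : State} {T : ℕ}
    (h₁ : c.Holds w inp s → Halts w inp p s T Q) (h₂ : ¬ c.Holds w inp s → Halts w inp q s T Q) :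
    Halts w inp (.branch c p q) s (c.cost + 1 + T) Q := by
  by_cases hc : c.Holds w inp s
  · obtain ⟨t, s', ht, he, hs⟩ := h₁ hc
    exact ⟨_, _, Nat.add_le_add_left ht _, .branch_true hc he, hs⟩
  · obtain ⟨t, s', ht, he, hs⟩ := h₂ hc
    exact ⟨_, _, Nat.add_le_add_left ht _, .branch_false hc he, hs⟩

/-- A loop halts if an invariant `I m` is kept while its parameter `m` decreases. -/
theorem Halts.loop {c : Test k} {p : Prog k} (I : ℕ → State → Prop)
    (hI : ∀ m s, I m s → c.Holds w inp s → wp w inp p (fun s' => ∃ m' < m, I m' s') s)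
    {m : ℕ} {s : State} (hs : I m s) :
    Halts w inp (.loop c p) s ((m + 1) * (Prog.loop c p).cost)
      (fun s' => (∃ m', I m' s') ∧ ¬ c.Holds w inp s') := by
  induction m using Nat.strong_induction_on generalizing s with
  | _ m ih =>
  by_cases hc : c.Holds w inp s
  · obtain ⟨t₁, s₁, ht₁, he₁, m', hm', hs₁⟩ := Halts.of_wp (hI m s hs hc)
    obtain ⟨t₂, s₂, ht₂, he₂, hs₂⟩ := ih m' hm' hs₁
    refine ⟨_, s₂, ?_, .loop_true hc he₁ he₂, hs₂⟩
    -- The drop from `m` to `m'` pays for the iteration just made.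
    have h1 : (m' + 1) * (Prog.loop c p).cost ≤ m * (Prog.loop c p).cost :=
      Nat.mul_le_mul_right _ hm'
    have h2 : (Prog.loop c p).cost = c.cost + 1 + p.cost := rfl
    rw [Nat.add_mul, one_mul]
    omega
  · refine ⟨_, s, ?_, .loop_false hc, ⟨m, hs⟩, hc⟩
    have h2 : (Prog.loop c p).cost = c.cost + 1 + p.cost := rfl
    rw [Nat.add_mul, one_mul]
    omega

end WordRAM

/-! ### The amortized scan for longest chains -/

namespace ChainScan

/-- `Links P c l`: following the pointers `P` from the pointer `c` yields the list `l`, where the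
pointer to `a` is `a + 1` and `0` is the null pointer. -/
def Links (P : ℕ → ℕ) : ℕ → List ℕ → Prop
  | c, [] => c = 0
  | c, a :: l => c = a + 1 ∧ Links P (P a) l

theorem Links.congr {P P' : ℕ → ℕ} {c : ℕ} {l : List ℕ} (h : Links P c l)
    (hP : ∀ a ∈ l, P a = P' a) : Links P' c l := by
  induction l generalizing c with
  | nil => exact h
  | cons a l ih =>
    refine ⟨h.1, ?_⟩
    rw [← hP a (by simp)]
    exact ih h.2 fun b hb => hP b (List.mem_cons_of_mem _ hb)

variable (n : ℕ) (h : ℕ → ℝ) (R : ℕ → ℕ → Prop)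

/-- A descending list of positions before `q`, of descending heights, all of which reach `q`. -/
def DescChain (q : ℕ) (l : List ℕ) : Prop :=
  l.Pairwise (fun a b => b < a ∧ h b < h a) ∧ ∀ a ∈ l, a < q ∧ R a q

variable {h R}

theorem DescChain.tail {q a : ℕ} {l : List ℕ} (hl : DescChain h R q (a :: l)) :
    DescChain h R q l :=
  ⟨hl.1.of_cons, fun b hb => hl.2 b (List.mem_cons_of_mem _ hb)⟩

theorem DescChain.cons {q a b : ℕ} {l : List ℕ} (hl : DescChain h R q (a :: l)) (hb : b < q)
    (hR : R b q) (hab : a < b) (hh : h a < h b) : DescChain h R q (b :: a :: l) := by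
  refine ⟨List.pairwise_cons.2 ⟨?_, hl.1⟩, ?_⟩
  · intro c hc
    rcases List.mem_cons.1 hc with rfl | hc
    · exact ⟨hab, hh⟩
    · have := (List.pairwise_cons.1 hl.1).1 c hc
      exact ⟨this.1.trans hab, this.2.trans hh⟩
  · intro c hc
    rcases List.mem_cons.1 hc with rfl | hc
    · exact ⟨hb, hR⟩
    · exact hl.2 c hc

theorem DescChain.singleton {q a : ℕ} (ha : a < q) (hR : R a q) : DescChain h R q [a] :=
  ⟨List.pairwise_singleton _ _, by simp [ha, hR]⟩

theorem DescChain.length_le {q : ℕ} {l : List ℕ} (hl : DescChain h R q l) : l.length ≤ q := by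
  rw [← List.toFinset_card_of_nodup (hl.1.imp fun h => h.1.ne'), ← Finset.card_range q]
  exact Finset.card_le_card fun c hc => Finset.mem_range.2 (hl.2 c (List.mem_toFinset.1 hc)).1

variable (h R)

/-- The tables of the scan for `q`, after the positions before `p` have been processed. `L a`
bounds the length of the chains that end at `a`, and is exact for processed `a`; cell `k` of row
`q` of `M` points to the lowest processed position of level `k`; row `q` of `P` holds pointers to
predecessors. -/
structure Tables (q p : ℕ) (L M P : ℕ → ℕ) : Prop where
  q_le : q ≤ n
  p_le : p ≤ q
  upper : q < n → ∀ a l, DescChain h R q (a :: l) → l.length + 1 ≤ L a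
  level_le : ∀ a < n, L a ≤ n
  level_init : ∀ a < n, q ≤ a → L a = n
  lower : ∀ a < p, R a q → ∃ l, DescChain h R q (a :: l) ∧ l.length + 1 = L a ∧
    Links (fun c => P (q * (n + 1) + c)) (P (q * (n + 1) + a)) l
  none : ∀ k ≤ n, M (q * (n + 1) + k) = 0 → ∀ a < p, R a q → L a ≠ k
  some : ∀ k ≤ n, ∀ m, M (q * (n + 1) + k) = m + 1 →
    m < p ∧ R m q ∧ L m = k ∧ ∀ a < p, R a q → L a = k → h m ≤ h a
  fresh : ∀ j, (q + 1) * (n + 1) ≤ j → M j = 0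

/-- The best solution so far: the position `bq` and a chain, given by the pointer `bp`. -/
structure Best (q p best bq bp : ℕ) (L P : ℕ → ℕ) : Prop where
  bq_lt : bq < n
  upper : ∀ q' < q, ∀ l, DescChain h R q' l → (∀ a ∈ l, h a < h q') → l.length + 1 ≤ best
  upper_row : ∀ a < p, R a q → h a < h q → L a + 1 ≤ best
  chain : ∃ l, l.length + 1 = best ∧ DescChain h R bq l ∧ (∀ a ∈ l, h a < h bq) ∧
    (∀ a ∈ l, bq * (n + 1) + a < q * (n + 1) + p) ∧
    Links (fun c => P (bq * (n + 1) + c)) bp l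

variable {n h R} {q p best bq bp : ℕ} {L M P : ℕ → ℕ}

theorem Tables.init (hn : 0 < n) (hL : ∀ a < n, L a = n) (hM : ∀ j, M j = 0) :
    Tables n h R 0 0 L M P where
  q_le := hn.le
  p_le := le_rfl
  upper _ a l hl := absurd (hl.2 a (by simp)).1 (Nat.not_lt_zero _)
  level_le a ha := (hL a ha).le
  level_init a ha _ := hL a ha
  lower a ha := absurd ha (Nat.not_lt_zero _)
  none _ _ _ a ha := absurd ha (Nat.not_lt_zero _)
  some k _ m hm := by rw [hM] at hm; omega
  fresh j _ := hM j

theorem Best.init (hn : 0 < n) : Best n h R 0 0 1 0 0 L P where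
  bq_lt := hn
  upper q' hq' := absurd hq' (Nat.not_lt_zero _)
  upper_row a ha := absurd ha (Nat.not_lt_zero _)
  chain := ⟨[], rfl, ⟨List.Pairwise.nil, by simp⟩, by simp, by simp, rfl⟩

theorem Tables.skip (H : Tables n h R q p L M P) (hp : p < q) (hR : ¬ R p q) :
    Tables n h R q (p + 1) L M P := by
  have key : ∀ a, a < p + 1 → R a q → a < p := fun a ha hr => by
    rcases Nat.lt_succ_iff_lt_or_eq.1 ha with ha | rfl
    · exact ha
    · exact absurd hr hR
  exact
  { q_le := H.q_le
    p_le := hp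
    upper := H.upper
    level_le := H.level_le
    level_init := H.level_init
    lower := fun a ha hr => H.lower a (key a ha hr) hr
    none := fun k hk h0 a ha hr => H.none k hk h0 a (key a ha hr) hr
    some := fun k hk m hm => by
      obtain ⟨h1, h2, h3, h4⟩ := H.some k hk m hm
      exact ⟨h1.trans (Nat.lt_succ_self _), h2, h3, fun a ha hr => h4 a (key a ha hr) hr⟩
    fresh := H.fresh }

theorem Best.skip (H : Best n h R q p best bq bp L P) (hR : R p q → h p < h q → L p + 1 ≤ best) :
    Best n h R q (p + 1) best bq bp L P where
  bq_lt := H.bq_lt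
  upper := H.upper
  upper_row a ha hr hh := by
    rcases Nat.lt_succ_iff_lt_or_eq.1 ha with ha | rfl
    · exact H.upper_row a ha hr hh
    · exact hR hr hh
  chain := by
    obtain ⟨l, h1, h2, h3, h4, h5⟩ := H.chain
    exact ⟨l, h1, h2, h3, fun a ha => (h4 a ha).trans (by omega), h5⟩

theorem Tables.level_pos (H : Tables n h R q p L M P) (hq : q < n) (hp : p < q) (hR : R p q) :
    1 ≤ L p :=
  H.upper hq p [] (DescChain.singleton hp hR)

/-- Suppose a chain of length `L p` ended at `p`, and let `b` be its next member. The bound `L b` is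
attained because `b` is processed, and extending its chain by `p` forces `L b = L p - 1`. The lowest
position of that level is then no higher than `b`, hence lower than `p`, against `hM`. -/
theorem Tables.decrease (H : Tables n h R q p L M P) (hq : q < n) (hp : p < q) (hR : R p q)
    (hk : L p ≠ 1)
    (hM : ¬ (0 < M (q * (n + 1) + (L p - 1)) ∧ h (M (q * (n + 1) + (L p - 1)) - 1) < h p)) :
    Tables n h R q p (Function.update L p (L p - 1)) M P := by
  have hpos := H.level_pos hq hp hR
  have hne : ∀ a < p, Function.update L p (L p - 1) a = L a := fun a ha =>
    Function.update_of_ne ha.ne _ _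
  exact
  { q_le := H.q_le
    p_le := H.p_le
    upper := fun _ a l hl => by
      by_cases hap : a = p
      · subst hap
        rw [Function.update_self]
        rcases l with _ | ⟨b, l⟩
        · simp only [List.length_nil]; omega
        by_contra hlen
        have h1 := H.upper hq a _ hl
        simp only [List.length_cons] at hlen h1
        have hab := (List.pairwise_cons.1 hl.1).1 b (by simp)
        have hRb := (hl.2 b (by simp)).2
        have h2 := H.upper hq b _ hl.tail
        obtain ⟨l', hl', hlen', -⟩ := H.lower b hab.1 hRb
        have h3 := H.upper hq a _ (hl'.cons hp hR hab.1 hab.2)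
        simp only [List.length_cons] at h3
        have hLb : L b = L a - 1 := by omega
        have hLn : L a - 1 ≤ n := (Nat.sub_le _ _).trans (H.level_le a (hp.trans hq))
        rcases hm : M (q * (n + 1) + (L a - 1)) with _ | m
        · exact H.none _ hLn hm b hab.1 hRb hLb
        · obtain ⟨-, -, -, h7⟩ := H.some _ hLn m hm
          refine hM ⟨by omega, ?_⟩
          rw [hm]
          exact lt_of_le_of_lt (h7 b hab.1 hRb hLb) hab.2
      · rw [Function.update_of_ne hap]
        exact H.upper hq a l hl
    level_le := fun a ha => by
      by_cases hap : a = p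
      · subst hap
        rw [Function.update_self]
        exact (Nat.sub_le _ _).trans (H.level_le a ha)
      · rw [Function.update_of_ne hap]
        exact H.level_le a ha
    level_init := fun a ha hqa => by
      rw [Function.update_of_ne (by omega)]
      exact H.level_init a ha hqa
    lower := fun a ha hr => by
      rw [hne a ha]
      exact H.lower a ha hr
    none := fun k hk h0 a ha hr => by
      rw [hne a ha]
      exact H.none k hk h0 a ha hr
    some := fun k hk m hm => by
      obtain ⟨h1, h2, h3, h4⟩ := H.some k hk m hm
      refine ⟨h1, h2, by rw [hne m h1]; exact h3, fun a ha hr hL => ?_⟩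
      rw [hne a ha] at hL
      exact h4 a ha hr hL
    fresh := H.fresh }

theorem Best.decrease (H : Best n h R q p best bq bp L P) (x : ℕ) :
    Best n h R q p best bq bp (Function.update L p x) P where
  bq_lt := H.bq_lt
  upper := H.upper
  upper_row a ha hr hh := by
    rw [Function.update_of_ne ha.ne]
    exact H.upper_row a ha hr hh
  chain := H.chain

/-- When `p` is placed at the level `L p`, a chain of that length ends at `p`. -/
theorem Tables.exists_chain (H : Tables n h R q p L M P) (hq : q < n) (hp : p < q) (hR : R p q)
    (hM : L p = 1 ∨
      (0 < M (q * (n + 1) + (L p - 1)) ∧ h (M (q * (n + 1) + (L p - 1)) - 1) < h p)) :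
    ∃ l, DescChain h R q (p :: l) ∧ l.length + 1 = L p ∧
      Links (fun c => P (q * (n + 1) + c)) (M (q * (n + 1) + (L p - 1))) l := by
  have hpos := H.level_pos hq hp hR
  have hLn : L p - 1 ≤ n := (Nat.sub_le _ _).trans (H.level_le p (hp.trans hq))
  rcases hm : M (q * (n + 1) + (L p - 1)) with _ | m
  · refine ⟨[], DescChain.singleton hp hR, ?_, rfl⟩
    rcases hM with hM | hM
    · exact hM.symm
    · omega
  · obtain ⟨h1, h2, h3, -⟩ := H.some _ hLn m hm
    obtain ⟨l, hl, hlen, hlink⟩ := H.lower m h1 h2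
    rcases hM with hM | hM
    · omega
    · rw [hm] at hM
      exact ⟨m :: l, hl.cons hp hR h1 hM.2, by simp only [List.length_cons]; omega, rfl, hlink⟩

/-- The table entry one level below supplies a chain that `p` extends, so the upper bound `L p` is
attained. Overwriting the cell of level `L p` is right because no earlier position of that level is
lower than `p`. -/
theorem Tables.place (H : Tables n h R q p L M P) (hq : q < n) (hp : p < q) (hR : R p q)
    (hM : L p = 1 ∨
      (0 < M (q * (n + 1) + (L p - 1)) ∧ h (M (q * (n + 1) + (L p - 1)) - 1) < h p)) :
    Tables n h R q (p + 1) L (Function.update M (q * (n + 1) + L p) (p + 1))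
      (Function.update P (q * (n + 1) + p) (M (q * (n + 1) + (L p - 1)))) := by
  have hLn : L p ≤ n := H.level_le p (hp.trans hq)
  -- Below its head a chain ending at `a ≤ p` contains only positions before `p`, so the new pointer
  -- at `p` is not read.
  have hcongr : ∀ a ≤ p, ∀ c l, DescChain h R q (a :: l) →
      Links (fun c => P (q * (n + 1) + c)) c l →
      Links (fun c => Function.update P (q * (n + 1) + p) (M (q * (n + 1) + (L p - 1)))
        (q * (n + 1) + c)) c l := by
    intro a ha c l hl hlink
    refine hlink.congr fun b hb => ?_
    have := (List.pairwise_cons.1 hl.1).1 b hb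
    exact (Function.update_of_ne (by omega) _ _).symm
  exact
  { q_le := H.q_le
    p_le := hp
    upper := H.upper
    level_le := H.level_le
    level_init := H.level_init
    lower := fun a ha hr => by
      rcases Nat.lt_succ_iff_lt_or_eq.1 ha with ha | rfl
      · obtain ⟨l, hl, hlen, hlink⟩ := H.lower a ha hr
        rw [Function.update_of_ne (by omega)]
        exact ⟨l, hl, hlen, hcongr a ha.le _ l hl hlink⟩
      · obtain ⟨l, hl, hlen, hlink⟩ := H.exists_chain hq hp hR hM
        rw [Function.update_self]
        exact ⟨l, hl, hlen, hcongr a le_rfl _ l hl hlink⟩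
    none := fun k hk h0 a ha hr hL => by
      by_cases hkp : k = L p
      · subst hkp
        rw [Function.update_self] at h0
        omega
      · rw [Function.update_of_ne (by omega)] at h0
        rcases Nat.lt_succ_iff_lt_or_eq.1 ha with ha | rfl
        · exact H.none k hk h0 a ha hr hL
        · exact hkp hL.symm
    some := fun k hk m hm => by
      by_cases hkp : k = L p
      · subst hkp
        rw [Function.update_self] at hm
        obtain rfl : p = m := by omega
        refine ⟨Nat.lt_succ_self _, hR, rfl, fun a ha hr hL => ?_⟩
        rcases Nat.lt_succ_iff_lt_or_eq.1 ha with ha | rfl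
        -- A lower `a` of the same level would give a chain of length `L p + 1` ending at `p`.
        · by_contra! hlt
          obtain ⟨l, hl, hlen, -⟩ := H.lower a ha hr
          have := H.upper hq p _ (hl.cons hp hR ha hlt)
          simp only [List.length_cons] at this
          omega
        · exact le_rfl
      · rw [Function.update_of_ne (by omega)] at hm
        obtain ⟨h1, h2, h3, h4⟩ := H.some k hk m hm
        refine ⟨h1.trans (Nat.lt_succ_self _), h2, h3, fun a ha hr hL => ?_⟩
        rcases Nat.lt_succ_iff_lt_or_eq.1 ha with ha | rfl
        · exact h4 a ha hr hL
        · exact absurd hL.symm hkp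
    fresh := fun j hj => by
      rw [Nat.add_mul] at hj
      rw [Function.update_of_ne (by omega)]
      exact H.fresh j (by rw [Nat.add_mul]; exact hj) }

/-- All pointers of the stored chain lie in cells before the one now written. -/
theorem Best.update_pointer (H : Best n h R q p best bq bp L P) (x : ℕ) :
    Best n h R q p best bq bp L (Function.update P (q * (n + 1) + p) x) where
  bq_lt := H.bq_lt
  upper := H.upper
  upper_row := H.upper_row
  chain := by
    obtain ⟨l, h1, h2, h3, h4, h5⟩ := H.chain
    exact ⟨l, h1, h2, h3, h4, h5.congr fun a ha =>
      (Function.update_of_ne (h4 a ha).ne _ _).symm⟩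

theorem Best.improve (H : Best n h R q p best bq bp L P)
    (HT : Tables n h R q (p + 1) L M P) (hq : q < n) (hp : p < q) (hR : R p q)
    (hh : h p < h q) (hb : best < L p + 1) :
    Best n h R q (p + 1) (L p + 1) q (p + 1) L P where
  bq_lt := hq
  upper q' hq' l hl hlh := (H.upper q' hq' l hl hlh).trans hb.le
  upper_row a ha hr hha := by
    rcases Nat.lt_succ_iff_lt_or_eq.1 ha with ha | rfl
    · exact (H.upper_row a ha hr hha).trans hb.le
    · exact le_rfl
  chain := by
    obtain ⟨l, hl, hlen, hlink⟩ := HT.lower p (Nat.lt_succ_self _) hR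
    have hlt := (List.pairwise_cons.1 hl.1).1
    refine ⟨p :: l, by simp [hlen], hl, ?_, ?_, rfl, hlink⟩
    · intro a ha
      rcases List.mem_cons.1 ha with rfl | ha
      · exact hh
      · exact (hlt a ha).2.trans hh
    · intro a ha
      rcases List.mem_cons.1 ha with rfl | ha
      · omega
      · have := hlt a ha
        omega

/-- A chain for `q + 1` with head before `q` is also a chain for `q`, so the old bounds survive. The
only new head is `q`, whose bound is still the initial `n`. The next row of `M` is still blank, so
nothing has to be cleared. -/
theorem Tables.next (H : Tables n h R q q L M P) (hq : q < n)
    (hR : ∀ a, q + 1 < n → R a (q + 1) → R a q) : Tables n h R (q + 1) 0 L M P where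
  q_le := hq
  p_le := Nat.zero_le _
  upper hq' a l hl := by
    have hb : ∀ b l, b < q → DescChain h R (q + 1) (b :: l) → DescChain h R q (b :: l) := by
      intro b l hb hl
      refine ⟨hl.1, fun c hc => ⟨?_, hR c hq' (hl.2 c hc).2⟩⟩
      rcases List.mem_cons.1 hc with rfl | hc
      · exact hb
      · exact ((List.pairwise_cons.1 hl.1).1 c hc).1.trans hb
    have haq := (hl.2 a (by simp)).1
    by_cases ha : a < q
    · exact H.upper hq a l (hb a l ha hl)
    · obtain rfl : a = q := by omega
      rw [H.level_init a hq le_rfl]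
      exact hl.length_le.trans hq'.le
  level_le := H.level_le
  level_init a ha hqa := H.level_init a ha (by omega)
  lower a ha := absurd ha (Nat.not_lt_zero _)
  none _ _ _ a ha := absurd ha (Nat.not_lt_zero _)
  some k _ m hm := by rw [H.fresh _ (Nat.le_add_right _ _)] at hm; omega
  fresh j hj := H.fresh j (le_trans (Nat.mul_le_mul_right _ (Nat.le_succ _)) hj)

/-- The length of a nonempty chain for `q` is at most the level of its head, which `upper_row` has
already compared with `best`. -/
theorem Best.next (H : Best n h R q q best bq bp L P) (HT : Tables n h R q q L M P) (hq : q < n) :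
    Best n h R (q + 1) 0 best bq bp L P where
  bq_lt := H.bq_lt
  upper q' hq' l hl hlh := by
    rcases Nat.lt_succ_iff_lt_or_eq.1 hq' with hq' | rfl
    · exact H.upper q' hq' l hl hlh
    · rcases l with _ | ⟨a, l⟩
      · obtain ⟨l, h1, -⟩ := H.chain
        simp only [List.length_nil]; omega
      · have ha := hl.2 a (by simp)
        have h1 := HT.upper hq a l hl
        have h2 := H.upper_row a ha.1 ha.2 (hlh a (by simp))
        simp only [List.length_cons]
        omega
  upper_row a ha := absurd ha (Nat.not_lt_zero _)
  chain := by
    obtain ⟨l, h1, h2, h3, h4, h5⟩ := H.chain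
    refine ⟨l, h1, h2, h3, fun a ha => (h4 a ha).trans_le ?_, h5⟩
    rw [Nat.add_mul]
    omega

end ChainScan

/-! ### From chains to maximum cliques -/

namespace LShape

/-- `g` lists the indices below `n` in the order of increasing `X`. -/
structure Enumerates {n : ℕ} (X : Fin n → ℝ) (g : ℕ → Fin n) : Prop where
  lt_iff : ∀ a < n, ∀ c < n, X (g a) < X (g c) ↔ a < c
  surj : ∀ i, ∃ a < n, g a = i

theorem exists_enumerates {n : ℕ} (hn : 0 < n) {X : Fin n → ℝ} (hX : Function.Injective X) :
    ∃ g, Enumerates X g := by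
  have hs : StrictMono (X ∘ Tuple.sort X) :=
    (Tuple.monotone_sort X).strictMono_of_injective (hX.comp (Tuple.sort X).injective)
  refine ⟨fun a => if h : a < n then Tuple.sort X ⟨a, h⟩ else ⟨0, hn⟩, ?_, ?_⟩
  · intro a ha c hc
    simp only [ha, hc, dif_pos]
    exact hs.lt_iff_lt (a := ⟨a, ha⟩) (b := ⟨c, hc⟩)
  · intro i
    refine ⟨(Tuple.sort X).symm i, ((Tuple.sort X).symm i).2, ?_⟩
    simp

theorem Enumerates.inj {n : ℕ} {X : Fin n → ℝ} {g : ℕ → Fin n} (hg : Enumerates X g) {a c : ℕ}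
    (ha : a < n) (hc : c < n) (h : g a = g c) : a = c := by
  have h1 := hg.lt_iff a ha c hc
  have h2 := hg.lt_iff c hc a ha
  rw [h] at h1 h2
  simp only [lt_irrefl, false_iff] at h1 h2
  omega

/-- Heights along an enumeration. -/
def heightAt {n : ℕ} (S : Fin n → LShape) (g : ℕ → Fin n) (a : ℕ) : ℝ := (S (g a)).height

/-- The shape at position `a` extends to the foot of the shape at position `q`. -/
def ReachAt {n : ℕ} (b : Bool) (S : Fin n → LShape) (g : ℕ → Fin n) (a q : ℕ) : Prop :=
  orient b (S (g q)).foot ≤ orient b (S (g a)).tip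

variable {n : ℕ} {b : Bool} {S : Fin n → LShape} {g : ℕ → Fin n}

theorem ReachAt.of_succ (hg : Enumerates (fun i => orient b (S i).foot) g) (a : ℕ) {q : ℕ}
    (hq : q + 1 < n) (h : ReachAt b S g a (q + 1)) : ReachAt b S g a q :=
  ((hg.lt_iff q (by omega) (q + 1) hq).2 (Nat.lt_succ_self q)).le.trans h

open ChainScan

/-- A longest solution of the scan is a maximum clique. -/
theorem isMaximumClique_of_chain (ht : Turns b S) (hgp : GeneralPosition S)
    (hg : Enumerates (fun i => orient b (S i).foot) g) {q : ℕ} (hq : q < n) {l : List ℕ}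
    (hl : DescChain (heightAt S g) (ReachAt b S g) q l)
    (hlh : ∀ a ∈ l, heightAt S g a < heightAt S g q)
    (hmax : ∀ q' < n, ∀ l', DescChain (heightAt S g) (ReachAt b S g) q' l' →
      (∀ a ∈ l', heightAt S g a < heightAt S g q') → l'.length + 1 ≤ l.length + 1) :
    ((q :: l).map g).Nodup ∧ (graph S).IsMaximumClique ((q :: l).map g).toFinset := by
  have hpw : (q :: l).Pairwise fun a c => Crosses b S (g c) (g a) := by
    refine List.pairwise_cons.2 ⟨fun a ha => ?_, ?_⟩
    · have h1 := hl.2 a ha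
      exact ⟨(hg.lt_iff a (h1.1.trans hq) q hq).2 h1.1, h1.2, hlh a ha⟩
    · refine hl.1.imp_of_mem fun {a c} ha hc hac => ?_
      have h1 := hl.2 a ha
      have h2 := hl.2 c hc
      refine ⟨(hg.lt_iff c (h2.1.trans hq) a (h1.1.trans hq)).2 hac.1, ?_, hac.2⟩
      exact ((hg.lt_iff a (h1.1.trans hq) q hq).2 h1.1).le.trans h2.2
  have hpw' : ((q :: l).map g).Pairwise fun i j => Crosses b S j i := List.pairwise_map.2 hpw
  have hnd : ((q :: l).map g).Nodup := hpw'.imp fun h e => by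
    rw [e] at h; exact lt_irrefl _ h.1
  refine ⟨hnd, ?_, ?_⟩
  · have hadj : ((q :: l).map g).Pairwise (graph S).Adj :=
      hpw'.imp fun h => (graph_adj_iff ht hgp).2 (Or.inr h)
    have : Std.Symm (graph S).Adj := ⟨fun _ _ h => h.symm⟩
    intro i hi j hj hij
    rw [Finset.mem_coe, List.mem_toFinset] at hi hj
    exact hadj.forall hi hj hij
  · intro t htc
    rw [List.toFinset_card_of_nodup hnd, List.length_map, List.length_cons]
    rcases t.eq_empty_or_nonempty with rfl | hne
    · simp
    obtain ⟨i, hi, his⟩ := exists_subset_N_of_isClique ht hgp htc hne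
    obtain ⟨q', hq', rfl⟩ := hg.surj i
    -- The positions of the other members of `t`; sorted in descending order they form a chain for
    -- `q'`, to which `hmax` applies.
    let A := (Finset.range n).filter fun a => g a ∈ t.erase (g q')
    have hA : ∀ a ∈ A, a < n ∧ g a ∈ t ∧ Crosses b S (g a) (g q') := fun a ha => by
      simp only [A, Finset.mem_filter, Finset.mem_range, Finset.mem_erase] at ha
      exact ⟨ha.1, ha.2.2, (mem_N_iff ht hgp).1 (his _ ha.2.2 ha.2.1)⟩
    have himg : A.image g = t.erase (g q') := by
      ext i
      simp only [A, Finset.mem_image, Finset.mem_filter, Finset.mem_range]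
      constructor
      · rintro ⟨a, ha, rfl⟩; exact ha.2
      · intro hi
        obtain ⟨a, ha, rfl⟩ := hg.surj i
        exact ⟨a, ⟨ha, hi⟩, rfl⟩
    have hcard : t.card ≤ A.card + 1 := by
      rw [← Finset.card_erase_add_one hi, ← himg]
      exact Nat.succ_le_succ Finset.card_image_le
    refine hcard.trans ?_
    rw [← Finset.length_sort (· ≥ ·)]
    refine hmax q' hq' _ ⟨?_, ?_⟩ ?_
    · have hs : (A.sort (· ≥ ·)).Pairwise (· > ·) := A.sortedGT_sort.pairwise
      refine hs.imp_of_mem fun {a c} ha hc hac => ⟨hac, ?_⟩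
      have h1 := hA a ((Finset.mem_sort _).1 ha)
      have h2 := hA c ((Finset.mem_sort _).1 hc)
      have hne : g c ≠ g a := fun e => (hac : c < a).ne (hg.inj h2.1 h1.1 e)
      rcases (graph_adj_iff ht hgp).1 (htc h2.2.1 h1.2.1 hne) with h | h
      · exact h.2.2
      · exact absurd ((hg.lt_iff a h1.1 c h2.1).1 h.1) (not_lt.2 (le_of_lt hac))
    · intro a ha
      have h1 := hA a ((Finset.mem_sort _).1 ha)
      exact ⟨(hg.lt_iff a h1.1 q' hq').1 h1.2.2.1, h1.2.2.2.1⟩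
    · intro a ha
      exact (hA a ((Finset.mem_sort _).1 ha)).2.2.2.2

end LShape

/-! ### The program and its sorting phase -/

namespace LShape

open WordRAM ChainScan

/-- The term `e + 1`. -/
abbrev succTerm (e : Term) : Term := .op .add e (.const 1)

/-- The term `e - 1`. -/
abbrev predTerm (e : Term) : Term := .op .sub e (.const 1)

/-- Run the programs of a list one after the other. -/
def block {k : ℕ} : List (Prog k) → Prog k
  | [] => .skip
  | p :: l => .seq p (block l)

/-- Shape `i` comes before shape `j`. -/
def footTest (b : Bool) (i j : Term) : Test 3 := if b then .input 0 i 0 j else .input 0 j 0 i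

/-- Shape `i` ends before the foot of shape `j`. -/
def endTest (b : Bool) (i j : Term) : Test 3 := if b then .input 2 i 0 j else .input 0 j 2 i

/-- Shape `i` is lower than shape `j`. -/
def heightTest (i j : Term) : Test 3 := .input 1 i 1 j

/-- Array `1` receives the enumeration of the shapes from left to right (or from right to left),
found by counting for each shape the shapes before it; array `2` is filled with `n`. -/
def sortLoop (b : Bool) : Prog 3 :=
  .loop (.lt (.var 1) (.var 0)) <|
    .branch (.lt (.var 2) (.var 0))
      (block [
        .branch (footTest b (.var 2) (.var 1)) (.assign 3 (succTerm (.var 3))) .skip,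
        .assign 2 (succTerm (.var 2))])
      (block [
        .write 1 (.var 3) (.var 1),
        .write 2 (.var 1) (.var 0),
        .assign 1 (succTerm (.var 1)),
        .assign 2 (.const 0),
        .assign 3 (.const 0)])

/-- Place the position in variable `2` at its level, and update the best solution. -/
def placeStep : Prog 3 :=
  block [
    .write 3 (.op .add (.var 3) (.read 2 (.var 2))) (succTerm (.var 2)),
    .write 4 (.op .add (.var 3) (.var 2)) (.var 9),
    .branch (.and (heightTest (.read 1 (.var 2)) (.read 1 (.var 1)))
        (.lt (.var 5) (succTerm (.read 2 (.var 2)))))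
      (block [
        .assign 5 (succTerm (.read 2 (.var 2))),
        .assign 6 (.var 1),
        .assign 7 (.var 3),
        .assign 8 (succTerm (.var 2))])
      .skip,
    .assign 2 (succTerm (.var 2))]

/-- The scan: variable `1` holds the position `q`, variable `2` the position `p < q`, variable `3`
the start of row `q` of the tables. -/
def scanLoop (b : Bool) : Prog 3 :=
  .loop (.lt (.var 1) (.var 0)) <|
    .branch (.lt (.var 2) (.var 1))
      (.branch (endTest b (.read 1 (.var 2)) (.read 1 (.var 1)))
        (.assign 2 (succTerm (.var 2)))
        (.seq (.assign 9 (.read 3 (.op .add (.var 3) (predTerm (.read 2 (.var 2))))))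
          (.branch (.or (.eq (.read 2 (.var 2)) (.const 1))
              (.and (.lt (.const 0) (.var 9))
                (heightTest (.read 1 (predTerm (.var 9))) (.read 1 (.var 2)))))
            placeStep
            (.write 2 (.var 2) (predTerm (.read 2 (.var 2)))))))
      (block [
        .assign 1 (succTerm (.var 1)),
        .assign 2 (.const 0),
        .assign 3 (.op .add (.var 3) (.var 4))])

/-- Follow the pointers from variable `8` and append the shapes to the output. -/
def outputLoop : Prog 3 :=
  .loop (.lt (.const 0) (.var 8)) <|
    block [
      .write 0 (.var 5) (.read 1 (predTerm (.var 8))),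
      .assign 5 (succTerm (.var 5)),
      .assign 8 (.read 4 (.op .add (.var 7) (predTerm (.var 8))))]

/-- Initialization of the scan. -/
def scanInit : Prog 3 :=
  block [
    .assign 1 (.const 0),
    .assign 2 (.const 0),
    .assign 3 (.const 0),
    .assign 4 (succTerm (.var 0)),
    .assign 5 (.const 1),
    .assign 6 (.const 0),
    .assign 7 (.const 0),
    .assign 8 (.const 0)]

/-- Initialization of the output. -/
def outputInit : Prog 3 :=
  block [
    .write 0 (.const 0) (.read 1 (.var 6)),
    .assign 5 (.const 1)]

/-- The program for shapes that turn clockwise (`b = true`) or anticlockwise (`b = false`). -/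
def cliqueProgOriented (b : Bool) : Prog 3 :=
  .seq (sortLoop b) <| .seq scanInit <| .seq (scanLoop b) <| .seq outputInit <|
    .seq outputLoop (.assign 0 (.var 5))

/-- The program for maximum cliques. -/
def cliqueProg : Prog 3 :=
  .branch (.eq (.var 0) (.const 0)) .skip <|
    .branch (.input 0 (.const 0) 2 (.const 0)) (cliqueProgOriented true) (cliqueProgOriented false)

variable {n : ℕ} {b : Bool} {S : Fin n → LShape} {g : ℕ → Fin n} {w : ℕ}

theorem holds_input {k : ℕ} {inp : Fin n → Fin k → ℝ} {s : State} {f f' : Fin k} {e e' : Term}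
    {i j : Fin n} (hi : e.eval w s = i) (hj : e'.eval w s = j) :
    (Test.input f e f' e').Holds w inp s ↔ inp i f < inp j f' := by
  simp only [Test.Holds]
  constructor
  · rintro ⟨h1, h2, h⟩
    simpa only [hi, hj, Fin.eta] using h
  · intro h
    refine ⟨hi ▸ i.2, hj ▸ j.2, ?_⟩
    simpa only [hi, hj, Fin.eta] using h

theorem holds_footTest {s : State} {e e' : Term} {i j : Fin n}
    (hi : e.eval w s = i) (hj : e'.eval w s = j) :
    (footTest b e e').Holds w (encode S) s ↔ orient b (S i).foot < orient b (S j).foot := by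
  cases b
  · simp [footTest, holds_input hj hi, encode, orient]
  · simp [footTest, holds_input hi hj, encode, orient]

theorem holds_endTest {s : State} {e e' : Term} {a q : ℕ}
    (hi : e.eval w s = g a) (hj : e'.eval w s = g q) :
    (endTest b e e').Holds w (encode S) s ↔ ¬ ReachAt b S g a q := by
  cases b
  · simp [endTest, holds_input hj hi, encode, orient, ReachAt]
  · simp [endTest, holds_input hi hj, encode, orient, ReachAt]

theorem holds_heightTest {s : State} {e e' : Term} {a q : ℕ}
    (hi : e.eval w s = g a) (hj : e'.eval w s = g q) :
    (heightTest e e').Holds w (encode S) s ↔ heightAt S g a < heightAt S g q := by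
  simp [heightTest, holds_input hi hj, encode, heightAt]

/-- The invariant of `sortLoop`; `m` bounds the number of remaining iterations. -/
structure SortInv (g : ℕ → Fin n) (m : ℕ) (s : State) : Prop where
  size : s.var 0 = n
  i_le : s.var 1 ≤ n
  j_le : s.var 2 ≤ n
  count : ∀ c < n, (g c : ℕ) = s.var 1 →
    s.var 3 = ((Finset.range c).filter fun a => (g a : ℕ) < s.var 2).card
  sorted : ∀ c < n, (g c : ℕ) < s.var 1 → s.arr 1 c = g c
  filled : ∀ i < s.var 1, s.arr 2 i = n
  unused : ∀ i, s.arr 3 i = 0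
  remaining : (n - s.var 1) * (n + 1) + (n - s.var 2) ≤ m

theorem SortInv.init (g : ℕ → Fin n) : SortInv g (n * (n + 1) + n) (State.init n) where
  size := by simp [State.init]
  i_le := by simp [State.init]
  j_le := by simp [State.init]
  count c _ _ := by simp [State.init]
  sorted c _ h := by simp [State.init] at h
  filled i h := by simp [State.init] at h
  unused i := by simp [State.init]
  remaining := by simp [State.init]

/-- One comparison of the counting sort: the counter of the shape at `c` grows exactly if the newly
inspected shape precedes it. -/
theorem card_filter_succ (hg : Enumerates (fun i => orient b (S i).foot) g) {c a : ℕ} (hc : c < n)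
    (ha : a < n) : ((Finset.range c).filter fun x => (g x : ℕ) < (g a : ℕ) + 1).card =
      ((Finset.range c).filter fun x => (g x : ℕ) < (g a : ℕ)).card + if a < c then 1 else 0 := by
  have key : ∀ x < n, ((g x : ℕ) < (g a : ℕ) + 1 ↔ (g x : ℕ) < (g a : ℕ) ∨ x = a) := by
    intro x hx
    rw [Nat.lt_succ_iff_lt_or_eq]
    exact or_congr_right ⟨fun h => hg.inj hx ha (Fin.ext h), fun h => h ▸ rfl⟩
  split_ifs with hac
  · have : ((Finset.range c).filter fun x => (g x : ℕ) < (g a : ℕ) + 1) =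
        insert a ((Finset.range c).filter fun x => (g x : ℕ) < (g a : ℕ)) := by
      ext x
      simp only [Finset.mem_filter, Finset.mem_insert, Finset.mem_range]
      constructor
      · rintro ⟨h1, h2⟩
        rcases (key x (h1.trans hc)).1 h2 with h | h
        · exact Or.inr ⟨h1, h⟩
        · exact Or.inl h
      · rintro (rfl | ⟨h1, h2⟩)
        · exact ⟨hac, Nat.lt_succ_self _⟩
        · exact ⟨h1, h2.trans (Nat.lt_succ_self _)⟩
    rw [this, Finset.card_insert_of_notMem (by simp)]
  · refine (congrArg Finset.card (Finset.ext fun x => ?_)).trans (Nat.add_zero _).symm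
    simp only [Finset.mem_filter, Finset.mem_range]
    refine and_congr_right fun h1 => ?_
    rw [key x (h1.trans hc)]
    exact or_iff_left fun h => hac (h ▸ h1)

theorem card_filter_all {c : ℕ} :
    ((Finset.range c).filter fun x => (g x : ℕ) < n).card = c := by
  rw [Finset.filter_true_of_mem fun x _ => (g x).2, Finset.card_range]

theorem SortInv.step (hw : ∀ x ≤ (n + 2) ^ 2, x % 2 ^ w = x)
    (hg : Enumerates (fun i => orient b (S i).foot) g) {m : ℕ} {s : State} (H : SortInv g m s)
    (hi : s.var 1 < n) :
    wp w (encode S) (.branch (.lt (.var 2) (.var 0))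
      (block [
        .branch (footTest b (.var 2) (.var 1)) (.assign 3 (succTerm (.var 3))) .skip,
        .assign 2 (succTerm (.var 2))])
      (block [
        .write 1 (.var 3) (.var 1),
        .write 2 (.var 1) (.var 0),
        .assign 1 (succTerm (.var 1)),
        .assign 2 (.const 0),
        .assign 3 (.const 0)])) (fun s' => ∃ m' < m, SortInv g m' s') s := by
  have hsz := H.size
  have hrem := H.remaining
  obtain ⟨c, hc, hci⟩ := hg.surj ⟨s.var 1, hi⟩
  have hci' : (g c : ℕ) = s.var 1 := by rw [hci]
  have hcount := H.count c hc hci'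
  have hle : s.var 3 ≤ n := by
    rw [hcount]
    refine (Finset.card_filter_le _ _).trans ?_
    rw [Finset.card_range]; exact hc.le
  have hsq : n + 2 ≤ (n + 2) ^ 2 := Nat.le_self_pow two_ne_zero _
  have e1 : 1 % 2 ^ w = 1 := hw 1 (by omega)
  have e2 : (s.var 1 + 1) % 2 ^ w = s.var 1 + 1 := hw _ (by omega)
  have e3 : (s.var 3 + 1) % 2 ^ w = s.var 3 + 1 := hw _ (by omega)
  have e4 : s.var 2 ≤ n → (s.var 2 + 1) % 2 ^ w = s.var 2 + 1 := fun h => hw _ (by omega)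
  refine ⟨fun hj => ?_, fun hj => ?_⟩
  · simp only [Test.Holds, Term.eval, hsz] at hj
    obtain ⟨a, ha, haj⟩ := hg.surj ⟨s.var 2, hj⟩
    have haj' : (g a : ℕ) = s.var 2 := by rw [haj]
    have hsucc : ∀ c' < n, (g c' : ℕ) = s.var 1 → s.var 3 + (if a < c then 1 else 0) =
        ((Finset.range c').filter fun x => (g x : ℕ) < s.var 2 + 1).card := by
      intro c' hc' h
      obtain rfl : c' = c := hg.inj hc' hc (Fin.ext (h.trans hci'.symm))
      rw [← haj', card_filter_succ hg hc ha, haj', ← hcount]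
    have hiff := hg.lt_iff a ha c hc
    simp only [block, wp]
    rw [holds_footTest (i := g a) (j := g c) (by simp [Term.eval, haj'])
      (by simp [Term.eval, hci']), hiff]
    refine ⟨fun hac => ⟨m - 1, by omega, ?_⟩, fun hac => ⟨m - 1, by omega, ?_⟩⟩
    · rw [if_pos hac] at hsucc
      constructor <;> simp [State.setVar, Term.eval, Op.eval, e1, e3, e4 hj.le]
      · exact hsz
      · exact H.i_le
      · exact hj
      · simpa [Nat.lt_succ_iff] using hsucc
      · exact H.sorted
      · exact H.filled
      · exact H.unused
      · omega
    · rw [if_neg hac] at hsucc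
      constructor <;> simp [State.setVar, Term.eval, Op.eval, e1, e4 hj.le]
      · exact hsz
      · exact H.i_le
      · exact hj
      · simpa [Nat.lt_succ_iff] using hsucc
      · exact H.sorted
      · exact H.filled
      · exact H.unused
      · omega
  · simp only [Test.Holds, Term.eval, hsz] at hj
    -- All shapes have been compared, so the counter equals the rank `c`.
    have hjn : s.var 2 = n := le_antisymm H.j_le (not_lt.1 hj)
    rw [hjn, card_filter_all] at hcount
    have hmul : (n - s.var 1) * (n + 1) = (n - (s.var 1 + 1)) * (n + 1) + (n + 1) := by
      rw [← Nat.succ_mul]; congr 1; omega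
    simp only [block, wp]
    refine ⟨m - 1, by omega, ?_⟩
    constructor <;> simp [State.setVar, State.setArr, Term.eval, Op.eval, e1, e2]
    · exact hsz
    · exact hi
    · intro c' hc' hlt
      by_cases hcc : c' = c
      · subst hcc
        rw [hcount, Function.update_self, hci']
      · rw [hcount, Function.update_of_ne hcc]
        refine H.sorted c' hc' (lt_of_le_of_ne hlt fun h => hcc ?_)
        exact hg.inj hc' hc (Fin.ext (h.trans hci'.symm))
    · intro i hi'
      by_cases hii : i = s.var 1
      · rw [hii, Function.update_self, hsz]
      · rw [Function.update_of_ne hii]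
        exact H.filled i (by omega)
    · exact H.unused
    · omega

end LShape

/-! ### Correctness of the scan and of the output loop -/

namespace LShape

open WordRAM ChainScan

variable {n : ℕ} {b : Bool} {S : Fin n → LShape} {g : ℕ → Fin n} {w : ℕ}

/-- The invariant of `scanLoop`; `m` bounds the number of remaining iterations. -/
structure ScanInv (b : Bool) (S : Fin n → LShape) (g : ℕ → Fin n) (m : ℕ) (s : State) : Prop where
  size : s.var 0 = n
  width : s.var 4 = n + 1
  base : s.var 3 = s.var 1 * (n + 1)
  bestBase : s.var 7 = s.var 6 * (n + 1)
  sorted : ∀ a < n, s.arr 1 a = g a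
  tables : Tables n (heightAt S g) (ReachAt b S g) (s.var 1) (s.var 2) (s.arr 2) (s.arr 3)
    (s.arr 4)
  best : Best n (heightAt S g) (ReachAt b S g) (s.var 1) (s.var 2) (s.var 5) (s.var 6) (s.var 8)
    (s.arr 2) (s.arr 4)
  remaining : ∑ a ∈ Finset.range n, s.arr 2 a + (n - s.var 1) * (n + 1) + (n - s.var 2) ≤ m

theorem ScanInv.place (hw : ∀ x ≤ (n + 2) ^ 2, x % 2 ^ w = x) {m : ℕ} {s : State}
    (H : ScanInv b S g m s) (hq : s.var 1 < n) (hp : s.var 2 < s.var 1)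
    (hR : ReachAt b S g (s.var 2) (s.var 1))
    (hx : s.var 9 = s.arr 3 (s.var 1 * (n + 1) + (s.arr 2 (s.var 2) - 1)))
    (hM : s.arr 2 (s.var 2) = 1 ∨
      (0 < s.arr 3 (s.var 1 * (n + 1) + (s.arr 2 (s.var 2) - 1)) ∧
        heightAt S g (s.arr 3 (s.var 1 * (n + 1) + (s.arr 2 (s.var 2) - 1)) - 1) <
          heightAt S g (s.var 2))) :
    wp w (encode S) placeStep (fun s' => ∃ m' < m, ScanInv b S g m' s') s := by
  have hpn := hp.trans hq
  have hL := H.tables.level_le _ hpn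
  -- Every table address stays below this bound, so no arithmetic wraps around.
  have hbase : s.var 1 * (n + 1) + (n + 1) ≤ (n + 2) ^ 2 := by nlinarith
  have hb := H.base
  have hrem := H.remaining
  have e1 : 1 % 2 ^ w = 1 := hw 1 (by omega)
  have e2 : (s.var 2 + 1) % 2 ^ w = s.var 2 + 1 := hw _ (by omega)
  have e3 : (s.var 1 * (n + 1) + s.arr 2 (s.var 2)) % 2 ^ w =
    s.var 1 * (n + 1) + s.arr 2 (s.var 2) := hw _ (by omega)
  have e4 : (s.var 1 * (n + 1) + s.var 2) % 2 ^ w = s.var 1 * (n + 1) + s.var 2 := hw _ (by omega)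
  have e5 : (s.arr 2 (s.var 2) + 1) % 2 ^ w = s.arr 2 (s.var 2) + 1 := hw _ (by omega)
  have hT := H.tables.place hq hp hR hM
  have hB := H.best.update_pointer (s.arr 3 (s.var 1 * (n + 1) + (s.arr 2 (s.var 2) - 1)))
  simp only [placeStep, block, wp]
  have hhold : ∀ s' : State, s'.var 2 = s.var 2 → s'.var 1 = s.var 1 → s'.arr 1 = s.arr 1 →
      ((heightTest (.read 1 (.var 2)) (.read 1 (.var 1))).Holds w (encode S) s' ↔
        heightAt S g (s.var 2) < heightAt S g (s.var 1)) := by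
    intro s' h2 h1 h3
    apply holds_heightTest
    · simp only [Term.eval, h2, h3, H.sorted _ hpn]
    · simp only [Term.eval, h1, h3, H.sorted _ hq]
  constructor
  · rintro ⟨h1, h2⟩
    rw [hhold _ (by simp [State.setArr]) (by simp [State.setArr]) (by simp [State.setArr])] at h1
    simp [Test.Holds, Term.eval, Op.eval, State.setArr, e1, e5] at h2
    refine ⟨m - 1, by omega, ?_⟩
    constructor <;> simp [State.setVar, State.setArr, Term.eval, Op.eval, e1, e2, e3, e4, e5, hb, hx]
    · exact H.size
    · exact H.width
    · exact H.sorted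
    · exact hT
    · exact hB.improve hT hq hp hR h1 (by omega)
    · omega
  · intro hc
    rw [Test.Holds, hhold _ (by simp [State.setArr]) (by simp [State.setArr])
      (by simp [State.setArr])] at hc
    simp [Test.Holds, Term.eval, Op.eval, State.setArr, e1, e5] at hc
    refine ⟨m - 1, by omega, ?_⟩
    constructor <;> simp [State.setVar, State.setArr, Term.eval, Op.eval, e1, e2, e3, e4, hb, hx]
    · exact H.size
    · exact H.width
    · exact H.bestBase
    · exact H.sorted
    · exact hT
    · exact hB.skip fun _ h => by have := hc h; omega
    · omega

/-- The potential in `remaining` drops in each case: advancing `p` lowers the last term, lowering a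
level reduces the sum by one, and advancing `q` gains `n + 1` while resetting `p` costs at most `n`.
-/
theorem ScanInv.step (hw : ∀ x ≤ (n + 2) ^ 2, x % 2 ^ w = x)
    (hg : Enumerates (fun i => orient b (S i).foot) g) {m : ℕ} {s : State}
    (H : ScanInv b S g m s) (hq : s.var 1 < n) :
    wp w (encode S) (.branch (.lt (.var 2) (.var 1))
      (.branch (endTest b (.read 1 (.var 2)) (.read 1 (.var 1)))
        (.assign 2 (succTerm (.var 2)))
        (.seq (.assign 9 (.read 3 (.op .add (.var 3) (predTerm (.read 2 (.var 2))))))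
          (.branch (.or (.eq (.read 2 (.var 2)) (.const 1))
              (.and (.lt (.const 0) (.var 9))
                (heightTest (.read 1 (predTerm (.var 9))) (.read 1 (.var 2)))))
            placeStep
            (.write 2 (.var 2) (predTerm (.read 2 (.var 2)))))))
      (block [
        .assign 1 (succTerm (.var 1)),
        .assign 2 (.const 0),
        .assign 3 (.op .add (.var 3) (.var 4))])) (fun s' => ∃ m' < m, ScanInv b S g m' s') s := by
  have hple := H.tables.p_le
  have hpn : s.var 2 < n := hple.trans_lt hq
  have hL := H.tables.level_le _ hpn
  have hbase : s.var 1 * (n + 1) + (n + 1) ≤ (n + 2) ^ 2 := by nlinarith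
  have hb := H.base
  have hrem := H.remaining
  have e1 : 1 % 2 ^ w = 1 := hw 1 (by omega)
  have e2 : (s.var 2 + 1) % 2 ^ w = s.var 2 + 1 := hw _ (by omega)
  have e3 : (s.var 1 + 1) % 2 ^ w = s.var 1 + 1 := hw _ (by omega)
  have e4 : (s.arr 2 (s.var 2) - 1) % 2 ^ w = s.arr 2 (s.var 2) - 1 := hw _ (by omega)
  have e5 : (s.var 1 * (n + 1) + (s.arr 2 (s.var 2) - 1)) % 2 ^ w =
    s.var 1 * (n + 1) + (s.arr 2 (s.var 2) - 1) := hw _ (by omega)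
  have e6 : (s.var 1 * (n + 1) + (n + 1)) % 2 ^ w = s.var 1 * (n + 1) + (n + 1) := hw _ hbase
  refine ⟨fun hp => ?_, fun hp => ?_⟩
  · simp only [Test.Holds, Term.eval] at hp
    refine ⟨fun hR => ?_, fun hR => ?_⟩ <;>
      rw [holds_endTest (g := g) (a := s.var 2) (q := s.var 1) (by simp [Term.eval, H.sorted _ hpn])
        (by simp [Term.eval, H.sorted _ hq])] at hR
    · refine ⟨m - 1, by omega, ?_⟩
      constructor <;> simp [State.setVar, Term.eval, Op.eval, e1, e2]
      · exact H.size
      · exact H.width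
      · exact hb
      · exact H.bestBase
      · exact H.sorted
      · exact H.tables.skip hp hR
      · exact H.best.skip fun h => absurd h hR
      · omega
    · rw [not_not] at hR
      set x := s.arr 3 (s.var 1 * (n + 1) + (s.arr 2 (s.var 2) - 1)) with hx
      have hset : s.setVar 9 (Term.eval w s
          (.read 3 (.op .add (.var 3) (predTerm (.read 2 (.var 2)))))) = s.setVar 9 x := by
        simp [Term.eval, Op.eval, e1, e4, e5, hb, hx]
      rw [wp, wp, hset]
      have H' : ScanInv b S g m (s.setVar 9 x) := by
        constructor <;> simp [State.setVar]
        · exact H.size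
        · exact H.width
        · exact hb
        · exact H.bestBase
        · exact H.sorted
        · exact H.tables
        · exact H.best
        · exact hrem
      have hxn : x ≤ n := by
        rcases hxm : x with _ | m'
        · omega
        · have := (H.tables.some _ (by omega) m' (hx ▸ hxm)).1
          omega
      have hcond : (Test.or (.eq (.read 2 (.var 2)) (.const 1))
          (.and (.lt (.const 0) (.var 9))
            (heightTest (.read 1 (predTerm (.var 9))) (.read 1 (.var 2))))).Holds w (encode S)
              (s.setVar 9 x) ↔ s.arr 2 (s.var 2) = 1 ∨
                (0 < x ∧ heightAt S g (x - 1) < heightAt S g (s.var 2)) := by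
        -- For the null pointer `x = 0` the truncated `x - 1` names position `0`, a legal access;
        -- the conjunct `0 < x` rejects it anyway.
        have e7 : (x - 1) % 2 ^ w = x - 1 := hw _ (by omega)
        have hht := holds_heightTest (g := g) (S := S) (w := w) (s := s.setVar 9 x)
          (e := .read 1 (predTerm (.var 9))) (e' := .read 1 (.var 2)) (a := x - 1) (q := s.var 2)
          (by simp [Term.eval, Op.eval, State.setVar, e1, e7, H.sorted _ (by omega : x - 1 < n)])
          (by simp [Term.eval, State.setVar, H.sorted _ hpn])
        simp only [Test.Holds, hht]
        simp [Term.eval, State.setVar, e1]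
      rw [wp, hcond]
      refine ⟨fun hM => ?_, fun hM => ?_⟩
      · refine ScanInv.place hw H' ?_ ?_ ?_ ?_ ?_ <;> simp [State.setVar]
        · exact hq
        · exact hp
        · exact hR
        · rfl
        · exact hM
      · rw [not_or] at hM
        have hpos := H.tables.level_pos hq hp hR
        have hsum : ∑ a ∈ Finset.range n,
            Function.update (s.arr 2) (s.var 2) (s.arr 2 (s.var 2) - 1) a + 1 =
              ∑ a ∈ Finset.range n, s.arr 2 a := by
          have hmem : s.var 2 ∈ Finset.range n := Finset.mem_range.2 hpn
          rw [Finset.sum_update_of_mem hmem, Finset.sdiff_singleton_eq_erase,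
            ← Finset.add_sum_erase _ _ hmem]
          omega
        rw [wp]
        refine ⟨m - 1, by omega, ?_⟩
        constructor <;> simp [State.setVar, State.setArr, Term.eval, Op.eval, e1, e4]
        · exact H.size
        · exact H.width
        · exact hb
        · exact H.bestBase
        · exact H.sorted
        · exact H.tables.decrease hq hp hR hM.1 hM.2
        · exact H.best.decrease _
        · omega
  · simp only [Test.Holds, Term.eval] at hp
    have hpq : s.var 2 = s.var 1 := le_antisymm hple (not_lt.1 hp)
    have hmul : (n - s.var 1) * (n + 1) = (n - (s.var 1 + 1)) * (n + 1) + (n + 1) := by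
      rw [← Nat.succ_mul]; congr 1; omega
    have hT := H.tables
    have hB := H.best
    rw [hpq] at hT hB
    simp only [block, wp]
    refine ⟨m - 1, by omega, ?_⟩
    constructor <;> simp [State.setVar, Term.eval, Op.eval, e1, e3, e6, hb, H.width]
    · exact H.size
    · rw [Nat.succ_mul]
    · exact H.bestBase
    · exact H.sorted
    · exact hT.next hq fun a h => ReachAt.of_succ hg a h
    · exact hB.next hT hq
    · omega

/-- The invariant of `outputLoop`, which outputs the positions `q :: l`; `m` is the number of
remaining iterations. -/
structure OutputInv (g : ℕ → Fin n) (q : ℕ) (l : List ℕ) (m : ℕ) (s : State) : Prop where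
  base : s.var 7 = q * (n + 1)
  sorted : ∀ a < n, s.arr 1 a = g a
  split : ∃ l₁ l₂, l = l₁ ++ l₂ ∧ Links (fun c => s.arr 4 (q * (n + 1) + c)) (s.var 8) l₂ ∧
    l₂.length = m ∧ s.var 5 = l₁.length + 1 ∧
    (List.range (s.var 5)).map (s.arr 0) = (q :: l₁).map fun a => (g a : ℕ)

theorem map_range_update (f : ℕ → ℕ) (k x : ℕ) :
    (List.range (k + 1)).map (Function.update f k x) = (List.range k).map f ++ [x] := by
  rw [List.range_succ, List.map_append, List.map_singleton, Function.update_self]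
  congr 1
  refine List.map_congr_left fun i hi => Function.update_of_ne ?_ _ _
  exact (List.mem_range.1 hi).ne

theorem OutputInv.step (hw : ∀ x ≤ (n + 2) ^ 2, x % 2 ^ w = x) {q : ℕ} {l : List ℕ} (hq : q < n)
    (hlq : ∀ a ∈ l, a < q) (hlen : l.length ≤ n) {m : ℕ} {s : State} (H : OutputInv g q l m s)
    (hc : 0 < s.var 8) :
    wp w (encode S) (block [
      .write 0 (.var 5) (.read 1 (predTerm (.var 8))),
      .assign 5 (succTerm (.var 5)),
      .assign 8 (.read 4 (.op .add (.var 7) (predTerm (.var 8))))])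
      (fun s' => ∃ m' < m, OutputInv g q l m' s') s := by
  obtain ⟨l₁, l₂, rfl, hlink, hm, h5, hout⟩ := H.split
  rcases l₂ with _ | ⟨a, l₂⟩
  · exact absurd hlink hc.ne'
  obtain ⟨h8, hlink⟩ := hlink
  have haq : a < q := hlq a (by simp)
  have hbase : q * (n + 1) + (n + 1) ≤ (n + 2) ^ 2 := by nlinarith
  simp only [List.length_append, List.length_cons] at hlen hm
  have e1 : 1 % 2 ^ w = 1 := hw 1 (by omega)
  have e2 : a % 2 ^ w = a := hw _ (by omega)
  have e3 : (l₁.length + 1 + 1) % 2 ^ w = l₁.length + 1 + 1 := hw _ (by omega)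
  have e4 : (q * (n + 1) + a) % 2 ^ w = q * (n + 1) + a := hw _ (by omega)
  simp only [block, wp]
  refine ⟨l₂.length, by omega, ?_⟩
  constructor
  · simp [State.setVar, State.setArr, H.base]
  · simpa [State.setVar, State.setArr] using H.sorted
  · refine ⟨l₁ ++ [a], l₂, by simp, ?_, rfl, ?_, ?_⟩
    · simpa [State.setVar, State.setArr, Term.eval, Op.eval, H.base, h8, e1, e2, e4] using hlink
    · simp [State.setVar, State.setArr, Term.eval, Op.eval, h5, e1, e3]
    · simp [State.setVar, State.setArr, Term.eval, Op.eval, h8, h5, e1, e2, e3]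
      rw [map_range_update, ← h5, hout, H.sorted _ (haq.trans hq)]
      simp

end LShape

/-! ### Total correctness and running time -/

namespace LShape

open WordRAM ChainScan

variable {n : ℕ} {b : Bool} {S : Fin n → LShape} {g : ℕ → Fin n} {w : ℕ}

/-- The state describes a maximum clique as its output. -/
def OutputsMaximumClique (S : Fin n → LShape) (s : State) : Prop :=
  ∃ Q : List (Fin n), Q.Nodup ∧ s.output = Q.map Fin.val ∧
    (graph S).IsMaximumClique Q.toFinset

theorem halts_sortLoop (hw : ∀ x ≤ (n + 2) ^ 2, x % 2 ^ w = x)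
    (hg : Enumerates (fun i => orient b (S i).foot) g) :
    Halts w (encode S) (sortLoop b) (State.init n)
      ((n * (n + 1) + n + 1) * (sortLoop b).cost) fun s => s.var 0 = n ∧
        (∀ c < n, s.arr 1 c = g c) ∧ (∀ i < n, s.arr 2 i = n) ∧ ∀ i, s.arr 3 i = 0 := by
  refine (Halts.loop (SortInv g) (fun m s H hc => H.step hw hg ?_) (SortInv.init g)).mono le_rfl ?_
  · simpa [Test.Holds, Term.eval, H.size] using hc
  · rintro s ⟨⟨m, H⟩, hc⟩
    simp only [Test.Holds, Term.eval, H.size] at hc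
    have hi : s.var 1 = n := le_antisymm H.i_le (not_lt.1 hc)
    exact ⟨H.size, fun c hc => H.sorted c hc (hi ▸ (g c).2), hi ▸ H.filled, H.unused⟩

theorem halts_scanInit (hn : 0 < n) (hw : ∀ x ≤ (n + 2) ^ 2, x % 2 ^ w = x) {s : State}
    (h0 : s.var 0 = n) (h1 : ∀ c < n, s.arr 1 c = g c) (h2 : ∀ i < n, s.arr 2 i = n)
    (h3 : ∀ i, s.arr 3 i = 0) :
    Halts w (encode S) scanInit s scanInit.cost
      (ScanInv b S g (n * n + n * (n + 1) + n)) := by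
  have hsq : n + 2 ≤ (n + 2) ^ 2 := Nat.le_self_pow two_ne_zero _
  have e1 : 1 % 2 ^ w = 1 := hw 1 (by omega)
  have e2 : (n + 1) % 2 ^ w = n + 1 := hw _ (by omega)
  have hsum : ∑ a ∈ Finset.range n, s.arr 2 a = n * n := by
    rw [Finset.sum_congr rfl fun a ha => h2 a (Finset.mem_range.1 ha)]
    simp
  apply Halts.of_wp
  simp only [scanInit, block, wp]
  constructor <;> simp [State.setVar, Term.eval, Op.eval, e1, e2, h0]
  · exact h1
  · exact Tables.init hn h2 h3
  · exact Best.init hn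
  · rw [hsum]

theorem halts_scanLoop (hw : ∀ x ≤ (n + 2) ^ 2, x % 2 ^ w = x)
    (hg : Enumerates (fun i => orient b (S i).foot) g) {m : ℕ} {s : State}
    (H : ScanInv b S g m s) :
    Halts w (encode S) (scanLoop b) s ((m + 1) * (scanLoop b).cost)
      fun s => (∃ m, ScanInv b S g m s) ∧ s.var 1 = n := by
  refine (Halts.loop (ScanInv b S g) (fun m s H hc => H.step hw hg ?_) H).mono le_rfl ?_
  · simpa [Test.Holds, Term.eval, H.size] using hc
  · rintro s ⟨⟨m, H⟩, hc⟩
    simp only [Test.Holds, Term.eval, H.size] at hc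
    exact ⟨⟨m, H⟩, le_antisymm H.tables.q_le (not_lt.1 hc)⟩

theorem halts_outputInit (hw : ∀ x ≤ (n + 2) ^ 2, x % 2 ^ w = x) {s : State} {q : ℕ} {l : List ℕ}
    (hq : q < n) (h1 : ∀ c < n, s.arr 1 c = g c) (h6 : s.var 6 = q) (h7 : s.var 7 = q * (n + 1))
    (hl : Links (fun c => s.arr 4 (q * (n + 1) + c)) (s.var 8) l) :
    Halts w (encode S) outputInit s outputInit.cost (OutputInv g q l l.length) := by
  have hsq : n + 2 ≤ (n + 2) ^ 2 := Nat.le_self_pow two_ne_zero _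
  have e1 : 1 % 2 ^ w = 1 := hw 1 (by omega)
  apply Halts.of_wp
  simp only [outputInit, block, wp]
  constructor
  · simpa [State.setVar, State.setArr] using h7
  · simpa [State.setVar, State.setArr] using h1
  · refine ⟨[], l, rfl, ?_, rfl, ?_, ?_⟩
    · simpa [State.setVar, State.setArr] using hl
    · simp [State.setVar, Term.eval, e1]
    · simp [State.setVar, State.setArr, Term.eval, e1, h6, h1 q hq]

theorem halts_outputLoop (hw : ∀ x ≤ (n + 2) ^ 2, x % 2 ^ w = x) {q : ℕ} {l : List ℕ}
    (hq : q < n) (hlq : ∀ a ∈ l, a < q) (hlen : l.length ≤ n) {m : ℕ} {s : State}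
    (H : OutputInv g q l m s) :
    Halts w (encode S) outputLoop s ((m + 1) * outputLoop.cost) fun s =>
      (List.range (s.var 5)).map (s.arr 0) = (q :: l).map fun a => (g a : ℕ) := by
  refine (Halts.loop (OutputInv g q l) (fun m s H hc => H.step hw hq hlq hlen ?_) H).mono le_rfl ?_
  · simpa [Test.Holds, Term.eval] using hc
  · rintro s ⟨⟨m, H⟩, hc⟩
    have h8 : s.var 8 = 0 := by simpa [Test.Holds, Term.eval] using hc
    obtain ⟨l₁, l₂, rfl, hlink, -, -, hout⟩ := H.split
    rcases l₂ with _ | ⟨a, l₂⟩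
    · rw [hout, List.append_nil]
    · exact absurd hlink.1 (by omega)

/-- Each phase makes at most `3 * (n + 1) ^ 2` iterations; the largest count is `2n² + 2n + 1`, in
the scan. -/
theorem halts_cliqueProgOriented (hn : 0 < n) (hw : ∀ x ≤ (n + 2) ^ 2, x % 2 ^ w = x)
    (ht : Turns b S) (hgp : GeneralPosition S) :
    Halts w (encode S) (cliqueProgOriented b) (State.init n)
      (3 * (n + 1) ^ 2 * (cliqueProgOriented b).cost) (OutputsMaximumClique S) := by
  obtain ⟨g, hg⟩ := exists_enumerates hn (orient_foot_injective b hgp)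
  refine ((halts_sortLoop hw hg).seq (T₂ := scanInit.cost +
    ((n * n + n * (n + 1) + n + 1) * (scanLoop b).cost + (outputInit.cost +
      ((n + 1) * outputLoop.cost + (Prog.assign (k := 3) 0 (.var 5)).cost))))
    fun s ⟨h0, h1, h2, h3⟩ => ?_).mono ?_ fun _ => id
  · refine (halts_scanInit (b := b) hn hw h0 h1 h2 h3).seq fun s H => ?_
    refine (halts_scanLoop hw hg H).seq fun s ⟨⟨m, H⟩, hend⟩ => ?_
    have hB := H.best
    rw [hend] at hB
    obtain ⟨l, hlen, hl, hlh, -, hlink⟩ := hB.chain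
    have hln : l.length ≤ n := hl.length_le.trans hB.bq_lt.le
    refine (halts_outputInit hw hB.bq_lt H.sorted rfl H.bestBase hlink).seq fun s H => ?_
    refine ((halts_outputLoop hw hB.bq_lt (fun a ha => (hl.2 a ha).1) hln H).mono
      (Nat.mul_le_mul_right _ (Nat.succ_le_succ hln)) fun _ => id).seq fun s hs => ?_
    apply Halts.of_wp
    obtain ⟨hnd, hmax⟩ := isMaximumClique_of_chain ht hgp hg hB.bq_lt hl hlh
      fun q' hq' l' hl' hlh' => hlen ▸ hB.upper q' hq' l' hl' hlh'
    refine ⟨_, hnd, ?_, hmax⟩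
    rw [List.map_map]
    simpa [State.output, State.setVar, Term.eval, Function.comp_def] using hs
  · simp only [cliqueProgOriented, Prog.cost.eq_4, Nat.mul_add]
    have hone : 1 ≤ 3 * (n + 1) ^ 2 := Nat.succ_le_of_lt (by positivity)
    have hk : ∀ a c : ℕ, a ≤ 3 * (n + 1) ^ 2 → a * c ≤ 3 * (n + 1) ^ 2 * c := fun a c h =>
      Nat.mul_le_mul_right _ h
    have h1 : ∀ c : ℕ, c ≤ 3 * (n + 1) ^ 2 * c := fun c => Nat.le_mul_of_pos_left _ hone
    gcongr
    · nlinarith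
    · exact h1 _
    · nlinarith
    · exact h1 _
    · nlinarith
    · exact h1 _

/-- Since the family is one-sided, comparing foot and tip of shape `0` reveals the common direction.
-/
theorem halts_cliqueProg (hw : ∀ x ≤ (n + 2) ^ 2, x % 2 ^ w = x) (hS : OneSided S)
    (hgp : GeneralPosition S) :
    Halts w (encode S) cliqueProg (State.init n) (3 * (n + 1) ^ 2 * cliqueProg.cost)
      (OutputsMaximumClique S) := by
  have hpos : 0 < 3 * (n + 1) ^ 2 := by positivity
  have hmul : ∀ a c d : ℕ, c ≤ d → a + 3 * (n + 1) ^ 2 * c ≤ 3 * (n + 1) ^ 2 * (a + d) := by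
    intro a c d h
    rw [Nat.mul_add]
    exact Nat.add_le_add (Nat.le_mul_of_pos_left _ hpos) (Nat.mul_le_mul_left _ h)
  refine (Halts.branch (T := 3 * (n + 1) ^ 2 * (max (Prog.skip (k := 3)).cost
    (Prog.branch (.input 0 (.const 0) 2 (.const 0)) (cliqueProgOriented true)
      (cliqueProgOriented false)).cost)) (fun h0 => ?_) (fun h0 => ?_)).mono
    (hmul _ _ _ le_rfl) fun _ => id
  · have hn : n = 0 := by simpa [Test.Holds, Term.eval, State.init] using h0
    subst hn
    refine (Halts.of_wp ?_).mono (le_trans (le_max_left _ _) (Nat.le_mul_of_pos_left _ hpos))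
      fun _ => id
    refine ⟨[], List.nodup_nil, by simp [State.output, State.init], ?_, ?_⟩
    · simp
    · intro t _
      simp [Finset.eq_empty_of_isEmpty t]
  · have hn : 0 < n := by
      have : n ≠ 0 := by simpa [Test.Holds, Term.eval, State.init] using h0
      omega
    have hfirst : (Test.input (k := 3) 0 (.const 0) 2 (.const 0)).Holds w (encode S)
        (State.init n) ↔ (S ⟨0, hn⟩).foot < (S ⟨0, hn⟩).tip := by
      rw [holds_input (i := ⟨0, hn⟩) (j := ⟨0, hn⟩) (by simp [Term.eval]) (by simp [Term.eval])]
      simp [encode]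
    obtain ⟨b, ht⟩ := hS.exists_turns
    have h0 := ht ⟨0, hn⟩
    refine (Halts.branch (T := 3 * (n + 1) ^ 2 *
      (max (cliqueProgOriented true).cost (cliqueProgOriented false).cost))
      (fun h => ?_) (fun h => ?_)).mono
      ((hmul _ _ _ le_rfl).trans (Nat.mul_le_mul_left _ (le_max_right _ _))) fun _ => id
    · rw [hfirst] at h
      cases b
      · simp only [orient, Bool.false_eq_true, if_false, neg_lt_neg_iff] at h0
        exact absurd h h0.asymm
      · exact (halts_cliqueProgOriented hn hw ht hgp).mono
          (Nat.mul_le_mul_left _ (le_max_left _ _)) fun _ => id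
    · rw [hfirst] at h
      cases b
      · exact (halts_cliqueProgOriented hn hw ht hgp).mono
          (Nat.mul_le_mul_left _ (le_max_right _ _)) fun _ => id
      · simp only [orient, if_true] at h0
        exact absurd h0 h

theorem isBigO_quadratic (C : ℕ) :
    (fun n : ℕ => ((3 * (n + 1) ^ 2 * C : ℕ) : ℝ)) =O[atTop]
      (fun n : ℕ => (n : ℝ) ^ 2 * Real.log (Real.log (n : ℝ))) := by
  refine IsBigO.of_bound (12 * C) ?_
  have hlog : Tendsto (fun n : ℕ => Real.log (Real.log (n : ℝ))) atTop atTop :=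
    Real.tendsto_log_atTop.comp (Real.tendsto_log_atTop.comp tendsto_natCast_atTop_atTop)
  filter_upwards [hlog.eventually_ge_atTop 1, eventually_ge_atTop 1] with n hn h1
  have h1' : (1 : ℝ) ≤ n := by exact_mod_cast h1
  rw [Real.norm_of_nonneg (by positivity), Real.norm_of_nonneg (by positivity)]
  push_cast
  have h2 : ((n : ℝ) + 1) ^ 2 ≤ 4 * (n : ℝ) ^ 2 := by nlinarith
  calc 3 * ((n : ℝ) + 1) ^ 2 * C ≤ 3 * (4 * (n : ℝ) ^ 2) * C := by gcongr
    _ = 12 * C * ((n : ℝ) ^ 2 * 1) := by ring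
    _ ≤ 12 * C * ((n : ℝ) ^ 2 * Real.log (Real.log n)) := by gcongr

end LShape

theorem theorem5 :
    -- one program finds a maximum clique, with running time `O(n² log log n)`,
    -- on words of any length that is at least `c · log₂ (n + 2)`
    (∃ (P : WordRAM.Prog 3) (c : ℕ) (T : ℕ → ℕ),
      1 ≤ c ∧
      (fun n : ℕ => (T n : ℝ)) =O[atTop]
        (fun n : ℕ => (n : ℝ) ^ 2 * Real.log (Real.log (n : ℝ))) ∧
      ∀ (n : ℕ) (S : Fin n → LShape), LShape.OneSided S → LShape.GeneralPosition S →
        ∀ w : ℕ, (n + 2) ^ c ≤ 2 ^ w →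
          ∃ (t : ℕ) (s : WordRAM.State),
            t ≤ T n ∧
            WordRAM.Exec w (LShape.encode S) P (WordRAM.State.init n) t s ∧
            ∃ Q : List (Fin n), Q.Nodup ∧ s.output = Q.map Fin.val ∧
              (LShape.graph S).IsMaximumClique Q.toFinset) ∧
    -- the recursion, and the structure of the subproblems
    (∀ (n : ℕ) (S : Fin n → LShape), LShape.OneSided S → LShape.GeneralPosition S →
      (0 < n → IsGreatest (Set.range fun q => LShape.D S (LShape.N S q) + 1)
        (LShape.D S Set.univ)) ∧
      ∀ q, IsPermutationGraph ((LShape.graph S).induce (LShape.N S q))) := by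

  refine ⟨⟨LShape.cliqueProg, 3, fun n => 3 * (n + 1) ^ 2 * LShape.cliqueProg.cost, by norm_num,
    LShape.isBigO_quadratic _, fun n S hS hg w hwc => ?_⟩, fun n S hS hg => ⟨fun hn => ?_,
    fun q => LShape.isPermutationGraph_induce_N hS hg q⟩⟩
  -- The exponent `3` makes the bound on `(n + 2) ^ 2` strict, as exact arithmetic modulo `2 ^ w`
  -- requires.
  · have hlt : (n + 2) ^ 2 < 2 ^ w := lt_of_lt_of_le
      (Nat.pow_lt_pow_right (by omega) (by norm_num)) hwc
    exact LShape.halts_cliqueProg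
      (fun x hx => Nat.mod_eq_of_lt (hx.trans_lt hlt)) hS hg
  · have : Nonempty (Fin n) := ⟨⟨0, hn⟩⟩
    exact LShape.isGreatest_D hS hg
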